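/- Let $c>0$ and let $\rho:\mathbb R^3\times\mathbb R\to\mathbb R$ and $\mathbf j:\mathbb R^3\times\mathbb R\to\mathbb R^3$ be $C^1$ functions of space and time satisfying the continuity equation $\operatorname{div}\mathbf j+\frac{\partial\rho}{\partial t}=0$. Assume that they admit temporal Fourier transforms $\rho_a$ and $\mathbf j_a$, in the sense that for every $r\in\mathbb R^3$ the functions $\rho_a(r,\cdot)$ and $\mathbf j_a(r,\cdot)$ are absolutely integrable and, for all $t\in\mathbb R$, $$\rho(r,t)=\frac1{\sqrt{2\pi}}\int_{\mathbb R}\rho_a(r,\omega)e^{-i\omega t}\,d\omega,\qquad \mathbf j(r,t)=\frac1{\sqrt{2\pi}}\int_{\mathbb R}\mathbf j_a(r,\omega)e^{-i\omega t}\,d\omega .$$ Assume moreover that at least one of the following two conditions holds. (a) $\rho$ and $\mathbf j$ are bounded, they vanish for all times outside a bounded set $D\subset\mathbb R^3$, and $\rho_a(r,\omega)=0$, $\mathbf j_a(r,\omega)=0$ for all $r$ and all $\omega$ outside a bounded set $B\subset\mathbb R$. (b) (No support conditions.) For $G_a=\rho_a$ and for $G_a$ each component of $\mathbf j_a$, the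 integrals $$\iint_{\mathbb R^3\times\mathbb R}(1+\omega^2)\,\frac{G_a(r,\omega)}{|r_0-r|}\,dV(r)\,d\omega$$ converge absolutely for every $r_0\in\mathbb R^3$, uniformly on compact sets of $r_0$: for every compact $K\subset\mathbb R^3$ and every $\varepsilon>0$ there is $R>0$ such that for all $r_0\in K$ the integral of the absolute value of the integrand over the set where $|r|>R$ or $|\omega|>R$ or $|r_0-r|<1/R$ is at most $\varepsilon$. Then the integrals defining the delayed (retarded) potentials $$\varphi(r_0,t)=\int_{\mathbb R^3}\frac{\rho(r,t-|r_0-r|/c)}{|r_0-r|}\,dV(r),\qquad \mathbf A(r_0,t)=\frac1c\int_{\mathbb R^3}\frac{\mathbf j(r,t-|r_0-r|/c)}{|r_0-r|}\,dV(r)$$ converge absolutely for all $(r_0,t)$; $\varphi$ and $\mathbf A$ are $C^2$ functions of space and time; and everywhere on $\mathbb R^3\times\mathbb R$ they satisfy the Lorenz gauge condition $$\operatorname{div}\mathbf A+\frac1c\frac{\partial\varphi}{\partial t}=0$$ and the wave equations $$\Delta\mathbf A-\frac1{c^2}\frac{\partial^2\mathbf A}{\partial t^2}=-\frac{4\pi}{c}\mathbf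 j,\qquad \Delta\varphi-\frac1{c^2}\frac{\partial^2\varphi}{\partial t^2}=-4\pi\rho .$$ Consequently the fields $\mathbf E=-\operatorname{grad}\varphi-\frac1c\frac{\partial\mathbf A}{\partial t}$ and $\mathbf H=\operatorname{rot}\mathbf A$ are $C^1$ and solve Maxwell's equations $$\operatorname{rot}\mathbf E+\frac1c\frac{\partial\mathbf H}{\partial t}=0,\quad \operatorname{rot}\mathbf H-\frac1c\frac{\partial\mathbf E}{\partial t}=\frac{4\pi}{c}\mathbf j,\quad \operatorname{div}\mathbf H=0,\quad \operatorname{div}\mathbf E=4\pi\rho .$$ -/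

import Mathlib

open MeasureTheory
open scoped Gradient Laplacian

namespace Electrodynamics

noncomputable section

/-- Physical space `ℝ³` with its Euclidean norm. A time dependent field with values in `V` is a
function `Space → ℝ → V` (position first, then time). -/
abbrev Space : Type := EuclideanSpace ℝ (Fin 3)

/-- The partial derivative `∂f/∂xᵢ` of a function on space. -/
def partialDeriv (i : Fin 3) (f : Space → ℝ) (x : Space) : ℝ :=
  fderiv ℝ f x (EuclideanSpace.single i 1)

/-- The divergence of a vector field on space. -/
def div (F : Space → Space) (x : Space) : ℝ :=
  ∑ i, partialDeriv i (fun y => F y i) x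

/-- The rotation (curl) of a vector field on space. -/
def rot (F : Space → Space) (x : Space) : Space :=
  !₂[partialDeriv 1 (fun y => F y 2) x - partialDeriv 2 (fun y => F y 1) x,
     partialDeriv 2 (fun y => F y 0) x - partialDeriv 0 (fun y => F y 2) x,
     partialDeriv 0 (fun y => F y 1) x - partialDeriv 1 (fun y => F y 0) x]

/-- `F` has continuous derivatives up to order `n`, jointly in space and time. -/
def IsRegular {V : Type*} [NormedAddCommGroup V] [NormedSpace ℝ V] (n : ℕ)
    (F : Space → ℝ → V) : Prop :=
  ContDiff ℝ n (fun p : Space × ℝ => F p.1 p.2)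

/-- The continuity equation `div j + ∂ρ/∂t = 0`. -/
def ContinuityEquation (ρ : Space → ℝ → ℝ) (j : Space → ℝ → Space) : Prop :=
  ∀ x t, div (fun y => j y t) x + deriv (ρ x) t = 0

/-! ### Sources: conditions in the frequency variable -/

/-- `fa` is the Fourier transform of the function of time `f`, in the sense that `fa` is
absolutely integrable and `f(t) = (2π)^(-1/2) ∫ fa(ω) exp(-iωt) dω`. -/
def HasTemporalTransform (f : ℝ → ℝ) (fa : ℝ → ℂ) : Prop :=
  Integrable fa ∧
    ∀ t, (f t : ℂ) =
      ((Real.sqrt (2 * Real.pi) : ℝ) : ℂ)⁻¹ * ∫ ω, fa ω * Complex.exp (-(Complex.I * ω * t))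

/-- The integrand `(1 + ω²) Ga(r, ω) / |r₀ - r|` on space-frequency. -/
def weighted (Ga : Space → ℝ → ℂ) (r₀ : Space) (p : Space × ℝ) : ℂ :=
  ((1 + p.2 ^ 2) / ‖r₀ - p.1‖) • Ga p.1 p.2

/-- The part of space-frequency that is cut off in the improper integral of `weighted Ga r₀`:
large `r`, large `ω`, or `r` close to the singular point `r₀`. -/
def cutOff (R : ℝ) (r₀ : Space) : Set (Space × ℝ) :=
  {p | R < ‖p.1‖ ∨ R < |p.2| ∨ ‖r₀ - p.1‖ < 1 / R}

/-- The integrals `∬ (1 + ω²) Ga(r, ω) / |r₀ - r| dV dω` exist and converge absolutely, uniformly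
for `r₀` in compact sets. -/
def UniformlyAbsolutelyConvergent (Ga : Space → ℝ → ℂ) : Prop :=
  (∀ r₀, Integrable (weighted Ga r₀)) ∧
    ∀ K : Set Space, IsCompact K → ∀ ε : ℝ, 0 < ε → ∃ R : ℝ, 0 < R ∧ ∀ r₀ ∈ K,
      ∫ p in cutOff R r₀, ‖weighted Ga r₀ p‖ ≤ ε

/-! ### Delayed potentials -/

/-- The integrand `G(r, t - d/c) / d`, `d = |r₀ - r|`, of a delayed potential at `(r₀, t)`. -/
def delayedIntegrand {V : Type*} [NormedAddCommGroup V] [NormedSpace ℝ V] (c : ℝ)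
    (G : Space → ℝ → V) (r₀ : Space) (t : ℝ) (r : Space) : V :=
  ‖r₀ - r‖⁻¹ • G r (t - ‖r₀ - r‖ / c)

/-- The delayed scalar potential `φ`. -/
def scalarPotential (c : ℝ) (ρ : Space → ℝ → ℝ) (r₀ : Space) (t : ℝ) : ℝ :=
  ∫ r, delayedIntegrand c ρ r₀ t r

/-- The delayed vector potential `A`. -/
def vectorPotential (c : ℝ) (j : Space → ℝ → Space) (r₀ : Space) (t : ℝ) : Space :=
  (1 / c) • ∫ r, delayedIntegrand c j r₀ t r

/-- The electric field `E = - grad φ - (1/c) ∂A/∂t` of a pair of potentials. -/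
def electricField (c : ℝ) (φ : Space → ℝ → ℝ) (A : Space → ℝ → Space) (x : Space) (t : ℝ) :
    Space :=
  -(∇ (fun y => φ y t) x) - (1 / c) • deriv (A x) t

/-- The magnetic field `H = rot A` of a vector potential. -/
def magneticField (A : Space → ℝ → Space) (x : Space) (t : ℝ) : Space :=
  rot (fun y => A y t) x

/-- `E`, `H` are a classical (continuously differentiable) solution of the Maxwell equations with
charge density `ρ` and current density `j`. -/
structure IsMaxwellSolution (c : ℝ) (ρ : Space → ℝ → ℝ) (j E H : Space → ℝ → Space) : Prop where
  regular_E : IsRegular 1 E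
  regular_H : IsRegular 1 H
  faraday : ∀ x t, rot (fun y => E y t) x + (1 / c) • deriv (H x) t = 0
  ampere : ∀ x t,
    rot (fun y => H y t) x - (1 / c) • deriv (E x) t = (4 * Real.pi / c) • j x t
  gauss_magnetic : ∀ x t, div (fun y => H y t) x = 0
  gauss_electric : ∀ x t, div (fun y => E y t) x = 4 * Real.pi * ρ x t

/-- `φ`, `A` are twice continuously differentiable, satisfy the Lorenz gauge condition, and solve
the wave equations with sources `ρ`, `j`. -/
structure IsPotentialSolution (c : ℝ) (ρ : Space → ℝ → ℝ) (j : Space → ℝ → Space)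
    (φ : Space → ℝ → ℝ) (A : Space → ℝ → Space) : Prop where
  regular_φ : IsRegular 2 φ
  regular_A : IsRegular 2 A
  lorenz_gauge : ∀ x t, div (fun y => A y t) x + (1 / c) * deriv (φ x) t = 0
  wave_A : ∀ x t,
    (Δ (fun y => A y t)) x - (1 / c ^ 2) • iteratedDeriv 2 (A x) t
      = -((4 * Real.pi / c) • j x t)
  wave_φ : ∀ x t,
    (Δ (fun y => φ y t)) x - (1 / c ^ 2) * iteratedDeriv 2 (φ x) t = -(4 * Real.pi * ρ x t)

/-- The delayed potentials of `ρ` and `j` exist (the integrals converge absolutely everywhere),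
satisfy the gauge condition and the wave equations, and the fields that they generate solve the
Maxwell equations. -/
structure DelayedPotentialsSolve (c : ℝ) (ρ : Space → ℝ → ℝ) (j : Space → ℝ → Space) : Prop where
  integrable_ρ : ∀ x t, Integrable (delayedIntegrand c ρ x t)
  integrable_j : ∀ x t, Integrable (delayedIntegrand c j x t)
  potentials : IsPotentialSolution c ρ j (scalarPotential c ρ) (vectorPotential c j)
  fields : IsMaxwellSolution c ρ j
    (electricField c (scalarPotential c ρ) (vectorPotential c j))
    (magneticField (vectorPotential c j))

end

end Electrodynamics

namespace Electrodynamics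

open Metric Set Filter
open scoped Topology

/-! Both alternatives (a) and (b) are reduced to one property of scalar sources, `AdmissibleSource`:
the source is jointly C¹, and for almost every `r` it is C² in time with value and first two time
derivatives bounded by a time-independent weight `M r`. The Newtonian potential of `M` converges,
and the part of it near the singularity is uniformly small (`KatoWeight`). In case (b) the weight is
`∫ (1 + ω²) |Ga r ω| dω`; in case (a) it is a constant on a ball, supplied by a Bernstein inequality
(`exists_bernstein`).

Write `d = |x - r|`. One derivative of the delayed kernel `f(r, t - d/c) / d` costs at most `d⁻²`,
which is integrable, so the potential is C¹ by differentiation under the integral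
(`IsKernel.hasPartials_integral`). A second spatial derivative would cost `d⁻³`. Therefore the
static kernel `ζ(d) f(r, t) / d` is split off, with a cut-off `ζ`, `ζ(0) = 1`. The remainder `h(d) /
d`, `h(d) = f(r, t - d/c) - ζ(d) f(r, t)`, has `h(0) = 0`, and Taylor's formula bounds its Hessian
by a multiple of `M r / d`; its Laplacian is `h''(d) / d` (`sum_regHess`). The static part is a
compactly supported convolution: its integrable gradient kernel carries one derivative and the C¹
source carries the other. Integration along rays gives its Laplacian, `-4πf` plus a term in `ζ''`
(`sum_integral_staticGrad`). The `ζ''` terms cancel, which leaves the wave equation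
(`exists_hasSecondPartials`).

For the gauge condition the current is multiplied by spatial cut-offs `χₙ`. For a compactly
supported current the derivative of the potential is the potential of the derivative, so the
continuity equation applies; the error terms contain `∇χₙ = O(1/n)` and vanish in the limit
(`lorenz_gauge_integral`). Maxwell's equations then follow from symmetry of second derivatives, the
wave equations, and the derivatives of the gauge identity. -/

/-- The linear form on space-time with spatial components `a` and temporal component `b`. -/
noncomputable def covector (a : Fin 3 → ℝ) (b : ℝ) : Space × ℝ →L[ℝ] ℝ :=
  (∑ i, a i • (EuclideanSpace.proj i : Space →L[ℝ] ℝ)).comp (ContinuousLinearMap.fst ℝ Space ℝ) +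
    b • ContinuousLinearMap.snd ℝ Space ℝ

lemma covector_apply (a : Fin 3 → ℝ) (b : ℝ) (v : Space × ℝ) :
    covector a b v = ∑ i, a i * v.1 i + b * v.2 := by
  simp [covector, Fin.sum_univ_three]

lemma contDiff_covector {F : Type*} [NormedAddCommGroup F] [NormedSpace ℝ F] {n : WithTop ℕ∞}
    {a : Fin 3 → F → ℝ} {b : F → ℝ}
    (ha : ∀ i, ContDiff ℝ n (a i)) (hb : ContDiff ℝ n b) :
    ContDiff ℝ n (fun p => covector (fun i => a i p) (b p)) := by
  unfold covector
  apply ContDiff.add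
  · apply ContDiff.clm_comp
    · exact ContDiff.sum fun i _ => (ha i).smul contDiff_const
    · exact contDiff_const
  · exact hb.smul contDiff_const

/-- `u` has the continuous partial derivatives `a i` in space and `b` in time. -/
structure HasPartials (u : Space × ℝ → ℝ) (a : Fin 3 → Space × ℝ → ℝ) (b : Space × ℝ → ℝ) :
    Prop where
  hasFDerivAt : ∀ p, HasFDerivAt u (covector (fun i => a i p) (b p)) p
  continuous_space : ∀ i, Continuous (a i)
  continuous_time : Continuous b

lemma HasPartials.contDiff_succ {u : Space × ℝ → ℝ} {a : Fin 3 → Space × ℝ → ℝ}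
    {b : Space × ℝ → ℝ} (h : HasPartials u a b) {n : ℕ} (ha : ∀ i, ContDiff ℝ n (a i))
    (hb : ContDiff ℝ n b) : ContDiff ℝ (n + 1 : ℕ) u := by
  have h1 : fderiv ℝ u = fun p => covector (fun i => a i p) (b p) :=
    funext fun p => (h.hasFDerivAt p).fderiv
  rw [show ((n + 1 : ℕ) : WithTop ℕ∞) = (n : WithTop ℕ∞) + 1 by push_cast; rfl,
    contDiff_succ_iff_fderiv]
  refine ⟨fun p => (h.hasFDerivAt p).differentiableAt, by simp, ?_⟩
  rw [h1]
  exact contDiff_covector ha hb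

lemma HasPartials.contDiff_one {u : Space × ℝ → ℝ} {a : Fin 3 → Space × ℝ → ℝ}
    {b : Space × ℝ → ℝ} (h : HasPartials u a b) : ContDiff ℝ 1 u := by
  have := h.contDiff_succ (n := 0) (fun i => contDiff_zero.2 (h.continuous_space i))
    (contDiff_zero.2 h.continuous_time)
  simpa using this

lemma HasPartials.add {u v : Space × ℝ → ℝ} {a a' : Fin 3 → Space × ℝ → ℝ}
    {b b' : Space × ℝ → ℝ} (h : HasPartials u a b) (h' : HasPartials v a' b') :
    HasPartials (fun p => u p + v p) (fun i p => a i p + a' i p) (fun p => b p + b' p) where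
  hasFDerivAt p := by
    convert! (h.hasFDerivAt p).add (h'.hasFDerivAt p) using 1
    ext v
    all_goals simp [covector_apply, Fin.sum_univ_three] ; try ring
  continuous_space i := (h.continuous_space i).add (h'.continuous_space i)
  continuous_time := h.continuous_time.add h'.continuous_time

/-! ### Weights -/

/-- A weight whose Newtonian potential converges, uniformly near the singularity. -/
structure KatoWeight (M : Space → ℝ) : Prop where
  nonneg : ∀ r, 0 ≤ M r
  integrable : ∀ x, Integrable fun r => M r / ‖x - r‖
  small : ∀ x₀ : Space, ∀ ε : ℝ, 0 < ε → ∃ δ > 0, ∀ x ∈ ball x₀ δ,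
    ∫ r in ball x₀ δ, M r / ‖x - r‖ ≤ ε

/-- In three dimensions the radial Jacobian `y ^ 2` cancels the singularity exactly. -/
lemma integrableOn_inv_norm_sq (R : ℝ) :
    IntegrableOn (fun s : Space => 1 / ‖s‖ ^ 2) (ball 0 R) := by
  refine (integrableOn_fun_norm_addHaar (E := Space) volume (f := fun y => 1 / y ^ 2)).2 ?_
  have : IntegrableOn (fun _ : ℝ => (1 : ℝ)) (Ioo 0 R) := by simp
  refine this.congr_fun (fun y hy => ?_) measurableSet_Ioo
  have := hy.1.ne'
  simp
  field_simp

lemma integrableOn_inv_dist_sq (x : Space) (R : ℝ) :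
    IntegrableOn (fun r : Space => 1 / ‖x - r‖ ^ 2) (ball x R) := by
  have h := integrableOn_inv_norm_sq R
  rw [← integrable_indicator_iff measurableSet_ball] at h ⊢
  convert! h.comp_sub_left x using 2 with r
  simp only [indicator, mem_ball, dist_eq_norm, sub_zero, norm_sub_rev]

lemma setIntegral_inv_dist_sq (x : Space) (R : ℝ) :
    ∫ r in ball x R, 1 / ‖x - r‖ ^ 2 = ∫ s in ball (0 : Space) R, 1 / ‖s‖ ^ 2 := by
  rw [← integral_indicator measurableSet_ball, ← integral_indicator measurableSet_ball,
    ← integral_sub_left_eq_self _ volume x]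
  congr 1
  ext r
  simp only [indicator, mem_ball, dist_eq_norm, sub_zero, sub_sub_cancel, norm_sub_rev _ x]

lemma exists_setIntegral_inv_norm_sq_lt {ε : ℝ} (hε : 0 < ε) :
    ∃ R > 0, ∫ s in ball (0 : Space) R, 1 / ‖s‖ ^ 2 < ε := by
  have h := tendsto_setIntegral_of_antitone (μ := volume)
    (s := fun n : ℕ => ball (0 : Space) (1 / (n + 1)))
    (f := fun s : Space => 1 / ‖s‖ ^ 2) (fun _ => measurableSet_ball)
    (fun m n hmn => ball_subset_ball (one_div_le_one_div_of_le (by positivity) (by gcongr)))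
    ⟨0, integrableOn_inv_norm_sq _⟩
  have h0 : ⋂ n : ℕ, ball (0 : Space) (1 / (n + 1)) = {0} := by
    refine Subset.antisymm (fun x hx => ?_) (by simp; intro i; positivity)
    by_contra hx0
    obtain ⟨n, hn⟩ := exists_nat_one_div_lt (norm_pos_iff.2 hx0)
    have := mem_iInter.1 hx n
    rw [mem_ball_zero_iff] at this
    linarith
  -- The limit is the integral over the single point `0`; it vanishes, and the integrand there is `1
  -- / 0 = 0` in any case.
  rw [h0, integral_singleton] at h
  simp only [norm_zero, ne_eq, OfNat.ofNat_ne_zero, not_false_eq_true, zero_pow, div_zero,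
    smul_zero] at h
  obtain ⟨n, hn⟩ := (h.eventually (gt_mem_nhds hε)).exists
  exact ⟨1 / (n + 1), by positivity, hn⟩

/-- The bound for kernels near `x₀`. -/
noncomputable def kernelBound (M : Space → ℝ) (x₀ x r : Space) : ℝ :=
  (ball x₀ 2).indicator (fun r => 1 / ‖x - r‖ ^ 2) r + M r / ‖x - r‖

section Kernels

variable {M : Space → ℝ}

lemma KatoWeight.kernelBound_nonneg (hM : KatoWeight M) (x₀ x r : Space) :
    0 ≤ kernelBound M x₀ x r :=
  add_nonneg (indicator_nonneg (fun _ _ => by positivity) _) (div_nonneg (hM.nonneg r) (norm_nonneg _))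

lemma KatoWeight.integrable_kernelBound (hM : KatoWeight M) (x₀ x : Space) :
    Integrable (kernelBound M x₀ x) := by
  refine Integrable.add ?_ (hM.integrable x)
  rw [integrable_indicator_iff measurableSet_ball]
  refine (integrableOn_inv_dist_sq x (2 + dist x₀ x)).mono_set (ball_subset_ball' ?_)
  linarith

/-- The centre `x` of the singularity moves with the parameter. For `δ ≤ R / 2` the ball about `x₀`
lies in the ball of radius `R` about `x`, where the integral of the inverse square does not depend
on `x`. -/
lemma KatoWeight.kernelBound_small (hM : KatoWeight M) (x₀ : Space) {ε : ℝ} (hε : 0 < ε) :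
    ∃ δ > 0, ∀ x ∈ ball x₀ δ, ∫ r in ball x₀ δ, kernelBound M x₀ x r ≤ ε := by
  obtain ⟨δ, hδ, h⟩ := hM.small x₀ (ε / 2) (by linarith)
  obtain ⟨R, hR', hR⟩ := exists_setIntegral_inv_norm_sq_lt (half_pos hε)
  refine ⟨min δ (R / 2), by positivity, fun x hx => ?_⟩
  have hx' := mem_ball.1 hx
  have hxδ : x ∈ ball x₀ δ := ball_subset_ball (min_le_left _ _) hx
  have hi : Integrable ((ball x₀ 2).indicator (fun r => 1 / ‖x - r‖ ^ 2)) := by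
    rw [integrable_indicator_iff measurableSet_ball]
    exact (integrableOn_inv_dist_sq x (2 + dist x₀ x)).mono_set (ball_subset_ball' le_rfl |>.trans (by rw [add_comm]))
  unfold kernelBound
  rw [integral_add hi.integrableOn (hM.integrable x).integrableOn]
  have e1 : ∫ r in ball x₀ (min δ (R / 2)), M r / ‖x - r‖ ≤ ε / 2 :=
    (setIntegral_mono_set (hM.integrable x).integrableOn
      (Eventually.of_forall fun r => div_nonneg (hM.nonneg r) (norm_nonneg _))
      (LE.le.eventuallyLE (ball_subset_ball (min_le_left _ _)))).trans (h x hxδ)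
  have e2 : ∫ r in ball x₀ (min δ (R / 2)), (ball x₀ 2).indicator (fun r => 1 / ‖x - r‖ ^ 2) r ≤
      ∫ r in ball x R, 1 / ‖x - r‖ ^ 2 := by
    rw [← integral_indicator measurableSet_ball, ← integral_indicator measurableSet_ball]
    refine integral_mono_of_nonneg (Eventually.of_forall fun r => ?_)
      ((integrable_indicator_iff measurableSet_ball).2 (integrableOn_inv_dist_sq x R))
      (Eventually.of_forall fun r => ?_)
    · exact indicator_nonneg (fun r _ => indicator_nonneg (fun r _ => by positivity) _) _
    · by_cases hr : r ∈ ball x₀ (min δ (R / 2))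
      · have hr' : r ∈ ball x R := by
          rw [mem_ball] at hr ⊢
          have := dist_triangle_right r x x₀
          have := min_le_right δ (R / 2)
          linarith
        simp only [indicator_of_mem hr, indicator_of_mem hr']
        exact indicator_le_self' (fun r _ => by positivity) r
      · simp only [indicator_of_notMem hr]
        exact indicator_nonneg (fun r _ => by positivity) _
  rw [setIntegral_inv_dist_sq] at e2
  linarith

/-- For `x` within `δ / 2` of `x₀` and `r` at distance at least `δ`, one has `‖x - r‖ ≥ ‖x₀ - r‖ / 2
≥ δ / 2`. This gives a dominating function independent of `x`. -/
lemma KatoWeight.kernelBound_far (hM : KatoWeight M) {x₀ x r : Space} {δ : ℝ} (hδ : 0 < δ)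
    (hx : x ∈ ball x₀ (δ / 2)) (hr : r ∉ ball x₀ δ) :
    kernelBound M x₀ x r ≤
      (ball x₀ 2).indicator (fun _ => 4 / δ ^ 2) r + 2 * (M r / ‖x₀ - r‖) := by
  rw [mem_ball, not_lt, dist_eq_norm, norm_sub_rev] at hr
  rw [mem_ball, dist_eq_norm, norm_sub_rev] at hx
  have h1 : ‖x₀ - r‖ ≤ ‖x₀ - x‖ + ‖x - r‖ := norm_sub_le_norm_sub_add_norm_sub ..
  unfold kernelBound
  refine add_le_add (indicator_le_indicator ?_) ?_
  · rw [div_le_div_iff₀ (by nlinarith [norm_nonneg (x - r)]) (by positivity)]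
    nlinarith [norm_nonneg (x - r)]
  · have := hM.nonneg r
    rw [← mul_div_assoc, div_le_div_iff₀ (by linarith) (by linarith)]
    nlinarith

/-! ### Singular kernels -/

/-- A kernel on space-time with a singularity on the diagonal of space that is controlled by the
weight `M`. -/
structure IsKernel (M : Space → ℝ) (G : Space × ℝ → Space → ℝ) : Prop where
  measurable : Measurable fun z : (Space × ℝ) × Space => G z.1 z.2
  dominated : ∀ p₀ : Space × ℝ, ∃ C, 0 ≤ C ∧ ∀ᵐ r : Space, ∀ p ∈ ball p₀ 1, p.1 ≠ r →
    |G p r| ≤ C * kernelBound M p₀.1 p.1 r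
  continuousAt : ∀ᵐ r : Space, ∀ p : Space × ℝ, p.1 ≠ r → ContinuousAt (fun p => G p r) p

variable {G : Space × ℝ → Space → ℝ}

lemma ae_ne_point (x : Space) : ∀ᵐ r : Space, x ≠ r := by
  have : ∀ᵐ r : Space, r ∉ ({x} : Set Space) := measure_eq_zero_iff_ae_notMem.1 (by simp)
  filter_upwards [this] with r hr h
  exact hr h.symm

lemma IsKernel.aestronglyMeasurable (hG : IsKernel M G) (p : Space × ℝ) :
    AEStronglyMeasurable (G p) :=
  (hG.measurable.comp measurable_prodMk_left).aestronglyMeasurable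

lemma IsKernel.integrable (hM : KatoWeight M) (hG : IsKernel M G) (p : Space × ℝ) :
    Integrable (G p) := by
  obtain ⟨C, hC, h⟩ := hG.dominated p
  refine ((hM.integrable_kernelBound p.1 p.1).const_mul C).mono' (hG.aestronglyMeasurable p) ?_
  filter_upwards [h, ae_ne_point p.1] with r hr hne
  exact hr p (mem_ball_self one_pos) hne

lemma IsKernel.abs (hG : IsKernel M G) : IsKernel M fun p r => |G p r| where
  measurable := hG.measurable.norm
  dominated p₀ := by simpa using hG.dominated p₀
  continuousAt := by
    filter_upwards [hG.continuousAt] with r hr p hp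
    exact (hr p hp).abs

lemma mem_ball_fst {p p₀ : Space × ℝ} {δ : ℝ} (h : p ∈ ball p₀ δ) : p.1 ∈ ball p₀.1 δ := by
  rw [mem_ball, Prod.dist_eq, max_lt_iff] at h
  exact h.1

/-- Dominated convergence does not apply directly, because the singularity sits at the moving point
`p.1`. A small ball about `p₀.1` contributes uniformly little; outside it `kernelBound_far` supplies
a fixed majorant. -/
lemma IsKernel.continuous_integral (hM : KatoWeight M) (hG : IsKernel M G) :
    Continuous fun p => ∫ r, G p r := by
  rw [Metric.continuous_iff']
  intro p₀ ε hε
  obtain ⟨C, hC, hdom⟩ := hG.dominated p₀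
  -- The near parts at `p` and at `p₀` take `ε / 4` each, the far part takes `ε / 2`; `C + 1` avoids
  -- division by zero.
  obtain ⟨δ, hδ, hsmall⟩ := hM.kernelBound_small p₀.1
    (show 0 < ε / (4 * (C + 1)) by positivity)
  set S := ball p₀.1 δ with hS
  have near : ∀ p ∈ ball p₀ (min δ 1), |∫ r in S, G p r| ≤ ε / 4 := by
    intro p hp
    have hpδ := mem_ball_fst (ball_subset_ball (min_le_left _ _) hp)
    have hp1 := ball_subset_ball (min_le_right _ _) hp
    have h1 : |∫ r in S, G p r| ≤ ∫ r in S, C * kernelBound M p₀.1 p.1 r := by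
      refine norm_integral_le_of_norm_le (μ := volume.restrict S) (f := G p)
        ((hM.integrable_kernelBound p₀.1 p.1).const_mul C).integrableOn (ae_restrict_of_ae ?_)
      filter_upwards [hdom, ae_ne_point p.1] with r hr hne
      exact hr p hp1 hne
    rw [integral_const_mul] at h1
    refine h1.trans ((mul_le_mul_of_nonneg_left (hsmall p.1 hpδ) hC).trans ?_)
    rw [← mul_div_assoc, div_le_div_iff₀ (by positivity) (by positivity)]
    nlinarith
  have far : ContinuousAt (fun p => ∫ r in Sᶜ, G p r) p₀ := by
    refine continuousAt_of_dominated (bound := fun r => C *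
      ((ball p₀.1 2).indicator (fun _ => 4 / δ ^ 2) r + 2 * (M r / ‖p₀.1 - r‖)))
      (Eventually.of_forall fun p => (hG.aestronglyMeasurable p).restrict) ?_ ?_ ?_
    · have hpos : 0 < min (δ / 2) 1 := by positivity
      filter_upwards [ball_mem_nhds p₀ hpos] with p hp
      have hpδ := mem_ball_fst (ball_subset_ball (min_le_left _ _) hp)
      have hp1 := ball_subset_ball (min_le_right _ _) hp
      rw [ae_restrict_iff' measurableSet_ball.compl]
      filter_upwards [hdom, ae_ne_point p.1] with r hr hne hrS
      exact (hr p hp1 hne).trans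
        (mul_le_mul_of_nonneg_left (hM.kernelBound_far hδ hpδ hrS) hC)
    · refine Integrable.integrableOn (Integrable.const_mul (Integrable.add ?_ ?_) C)
      · rw [integrable_indicator_iff measurableSet_ball]
        exact integrableOn_const measure_ball_lt_top.ne
      · exact (hM.integrable p₀.1).const_mul 2
    · refine ae_restrict_of_ae ?_
      filter_upwards [hG.continuousAt, ae_ne_point p₀.1] with r hr hne
      exact hr p₀ hne
  filter_upwards [ball_mem_nhds p₀ (show 0 < min δ 1 by positivity),
    (Metric.continuousAt_iff'.1 far) (ε / 2) (by positivity)] with p hp hfar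
  have e1 := near p hp
  have e2 := near p₀ (mem_ball_self (by positivity))
  rw [← integral_add_compl measurableSet_ball (hG.integrable hM p),
    ← integral_add_compl measurableSet_ball (hG.integrable hM p₀)]
  rw [Real.dist_eq] at hfar ⊢
  rw [abs_lt] at hfar ⊢
  rw [abs_le] at e1 e2
  constructor <;> linarith [hfar.1, hfar.2, e1.1, e1.2, e2.1, e2.2]

/-! ### Differentiation of integrals with moving singularities. -/

lemma ae_segment_ne (x v : Space) : ∀ᵐ r : Space, ∀ σ : ℝ, x + σ • v ≠ r := by
  have h0 : volume ((Submodule.span ℝ {v} : Submodule ℝ Space) : Set Space) = 0 := by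
    -- A line, or a point when `v = 0`, is a proper subspace of a three-dimensional space, hence
    -- null.
    refine Measure.addHaar_submodule _ _ fun h => ?_
    have h1 := finrank_span_le_card (R := ℝ) ({v} : Set Space)
    rw [h, finrank_top] at h1
    simp at h1
  have h1 : volume ((fun y => y - x) ⁻¹' ((Submodule.span ℝ {v} : Submodule ℝ Space) : Set Space))
      = 0 := by
    rw [(measurePreserving_sub_right volume x).measure_preimage
      (Submodule.closed_of_finiteDimensional _).measurableSet.nullMeasurableSet, h0]
  filter_upwards [measure_eq_zero_iff_ae_notMem.1 h1] with r hr σ h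
  apply hr
  rw [← h]
  simpa using Submodule.smul_mem _ σ (Submodule.mem_span_singleton_self v)

/-- A function whose increments are the integrals of a continuous family of linear forms along
segments is differentiable. -/
lemma hasFDerivAt_of_segment {E : Type*} [NormedAddCommGroup E] [NormedSpace ℝ E] {J : E → ℝ}
    {L : E → E →L[ℝ] ℝ} (hL : Continuous L)
    (h : ∀ p v, J (p + v) - J p = ∫ σ in (0 : ℝ)..1, L (p + σ • v) v) (p : E) :
    HasFDerivAt J (L p) p := by
  rw [hasFDerivAt_iff_isLittleO_nhds_zero, Asymptotics.isLittleO_iff]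
  intro ε hε
  obtain ⟨δ, hδ, hball⟩ := Metric.continuousAt_iff.1 (hL.continuousAt (x := p)) ε hε
  filter_upwards [ball_mem_nhds (0 : E) hδ] with v hv
  rw [mem_ball_zero_iff] at hv
  have hc : Continuous fun σ : ℝ => L (p + σ • v) v := by fun_prop
  have e : J (p + v) - J p - L p v = ∫ σ in (0 : ℝ)..1, (L (p + σ • v) v - L p v) := by
    rw [h, intervalIntegral.integral_sub (hc.intervalIntegrable _ _) (by simp)]
    simp
  rw [e]
  refine (intervalIntegral.norm_integral_le_of_norm_le_const (C := ε * ‖v‖) fun σ hσ => ?_).trans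
    (by simp)
  rw [uIoc_of_le zero_le_one] at hσ
  rw [← sub_apply]
  refine (ContinuousLinearMap.le_opNorm _ _).trans (mul_le_mul_of_nonneg_right ?_ (norm_nonneg v))
  rw [← dist_eq_norm]
  refine (hball ?_).le
  rw [dist_eq_norm, add_sub_cancel_left, norm_smul, Real.norm_of_nonneg hσ.1.le]
  nlinarith [hσ.2, norm_nonneg v]

/-- A kernel is integrable on the product of a segment in space-time and space. -/
lemma IsKernel.integrable_segment (hM : KatoWeight M) (hG : IsKernel M G) (p v : Space × ℝ) :
    Integrable (fun z : ℝ × Space => G (p + z.1 • v) z.2)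
      ((volume.restrict (Ioc (0 : ℝ) 1)).prod volume) := by
  have hm : Measurable fun z : ℝ × Space => G (p + z.1 • v) z.2 :=
    hG.measurable.comp (f := fun z : ℝ × Space => (p + z.1 • v, z.2)) (by fun_prop)
  rw [integrable_prod_iff hm.aestronglyMeasurable]
  refine ⟨Eventually.of_forall fun σ => hG.integrable hM (p + σ • v), ?_⟩
  -- The absolute value of a kernel is again a kernel, so its integral is continuous in `σ`, hence
  -- integrable over the segment.
  have hc : Continuous fun σ : ℝ => ∫ r, ‖G (p + σ • v) r‖ :=
    (hG.abs.continuous_integral hM).comp (f := fun σ : ℝ => p + σ • v) (by fun_prop)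
  exact (hc.integrableOn_Icc (a := 0) (b := 1)).mono_set Ioc_subset_Icc_self

/-- Differentiation under the integral sign for singular kernels. -/
lemma IsKernel.hasPartials_integral (hM : KatoWeight M) (hG : IsKernel M G)
    {g : Fin 3 → Space × ℝ → Space → ℝ} {gt : Space × ℝ → Space → ℝ}
    (hg : ∀ i, IsKernel M (g i)) (hgt : IsKernel M gt)
    (hd : ∀ᵐ r : Space, ∀ p : Space × ℝ, p.1 ≠ r →
      HasFDerivAt (fun p => G p r) (covector (fun i => g i p r) (gt p r)) p) :
    HasPartials (fun p => ∫ r, G p r) (fun i p => ∫ r, g i p r) (fun p => ∫ r, gt p r) where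
  continuous_space i := (hg i).continuous_integral hM
  continuous_time := hgt.continuous_integral hM
  hasFDerivAt := by
    have hL : Continuous fun p : Space × ℝ =>
        covector (fun i => ∫ r, g i p r) (∫ r, gt p r) := by
      have := contDiff_covector (n := 0)
        (fun i => contDiff_zero.2 ((hg i).continuous_integral hM))
        (contDiff_zero.2 (hgt.continuous_integral hM))
      exact contDiff_zero.1 this
    refine hasFDerivAt_of_segment hL fun p v => ?_
    have hint : Integrable (fun z : ℝ × Space =>
        covector (fun i => g i (p + z.1 • v) z.2) (gt (p + z.1 • v) z.2) v)
        ((volume.restrict (Ioc (0 : ℝ) 1)).prod volume) := by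
      simp only [covector_apply]
      exact (integrable_finsetSum _ fun i _ =>
        ((hg i).integrable_segment hM p v).mul_const _).add
          ((hgt.integrable_segment hM p v).mul_const _)
    have e1 : ∀ σ : ℝ, covector (fun i => ∫ r, g i (p + σ • v) r) (∫ r, gt (p + σ • v) r) v =
        ∫ r, covector (fun i => g i (p + σ • v) r) (gt (p + σ • v) r) v := by
      intro σ
      simp only [covector_apply]
      rw [integral_add (integrable_finsetSum _ fun i _ =>
        ((hg i).integrable hM _).mul_const _) ((hgt.integrable hM _).mul_const _),
        integral_finsetSum _ fun i _ => ((hg i).integrable hM _).mul_const _]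
      simp only [integral_mul_const]
    simp only [e1]
    -- After Fubini the claim is the fundamental theorem of calculus along the segment for each
    -- fixed `r`; almost every `r` lies off the line that carries the segment, so no singularity is
    -- met.
    rw [intervalIntegral.integral_of_le zero_le_one, integral_integral_swap hint,
      ← integral_sub (hG.integrable hM _) (hG.integrable hM _)]
    refine integral_congr_ae ?_
    filter_upwards [hd, ae_segment_ne p.1 v.1, hgt.continuousAt,
      ae_all_iff.2 fun i => (hg i).continuousAt] with r hr hne hct hci
    rw [← intervalIntegral.integral_of_le zero_le_one]
    have hpath : ∀ σ : ℝ, HasDerivAt (fun σ : ℝ => p + σ • v) v σ := fun σ => by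
      simpa using ((hasDerivAt_id σ).smul_const v).const_add p
    have hderiv : ∀ σ : ℝ, HasDerivAt (fun σ : ℝ => G (p + σ • v) r)
        (covector (fun i => g i (p + σ • v) r) (gt (p + σ • v) r) v) σ := fun σ =>
      HasFDerivAt.comp_hasDerivAt (l := fun p => G p r) (f := fun σ : ℝ => p + σ • v) σ
        (hr (p + σ • v) (hne σ)) (hpath σ)
    rw [intervalIntegral.integral_eq_sub_of_hasDerivAt 
      (fun σ _ => hderiv σ)]
    · simp
    · apply Continuous.intervalIntegrable
      simp only [covector_apply]
      have hc : ∀ {φ : Space × ℝ → Space → ℝ},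
          (∀ p : Space × ℝ, p.1 ≠ r → ContinuousAt (fun p => φ p r) p) →
          Continuous fun σ : ℝ => φ (p + σ • v) r := fun {φ} h =>
        continuous_iff_continuousAt.2 fun σ =>
          (h (p + σ • v) (hne σ)).comp (f := fun σ : ℝ => p + σ • v) (hpath σ).continuousAt
      exact (continuous_finsetSum _ fun i _ => (hc (hci i)).mul continuous_const).add
        ((hc hct).mul continuous_const)

end Kernels

/-! ### Calculus with linear forms -/

section Calculus

variable {u v : Space × ℝ → ℝ} {a a' : Fin 3 → ℝ} {b b' : ℝ} {p : Space × ℝ}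

lemma HasFDerivAt.covector_congr (h : HasFDerivAt u (covector a b) p) (ha : ∀ i, a i = a' i)
    (hb : b = b') : HasFDerivAt u (covector a' b') p := by
  rwa [show a' = a from funext fun i => (ha i).symm, ← hb]

lemma HasFDerivAt.covector_sub (hu : HasFDerivAt u (covector a b) p)
    (hv : HasFDerivAt v (covector a' b') p) :
    HasFDerivAt (fun p => u p - v p) (covector (fun i => a i - a' i) (b - b')) p := by
  convert! hu.sub hv using 1
  ext w
  all_goals simp [covector_apply, Fin.sum_univ_three] ; try ring

lemma HasFDerivAt.covector_mul (hu : HasFDerivAt u (covector a b) p)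
    (hv : HasFDerivAt v (covector a' b') p) :
    HasFDerivAt (fun p => u p * v p)
      (covector (fun i => a i * v p + u p * a' i) (b * v p + u p * b')) p := by
  convert! hu.mul hv using 1
  ext w
  all_goals simp [covector_apply, Fin.sum_univ_three] ; try ring

lemma HasFDerivAt.covector_comp {F : ℝ → ℝ} {F' : ℝ} (hF : HasDerivAt F F' (u p))
    (hu : HasFDerivAt u (covector a b) p) :
    HasFDerivAt (fun p => F (u p)) (covector (fun i => F' * a i) (F' * b)) p := by
  convert! hF.comp_hasFDerivAt p hu using 1
  ext w
  all_goals simp [covector_apply, Fin.sum_univ_three] ; try ring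

lemma HasFDerivAt.covector_div (hu : HasFDerivAt u (covector a b) p)
    (hv : HasFDerivAt v (covector a' b') p) (h0 : v p ≠ 0) :
    HasFDerivAt (fun p => u p / v p)
      (covector (fun i => (a i - u p / v p * a' i) / v p) ((b - u p / v p * b') / v p)) p := by
  have h := HasFDerivAt.covector_mul hu (HasFDerivAt.covector_comp (hasDerivAt_inv h0) hv)
  refine HasFDerivAt.covector_congr h (fun i => ?_) ?_ <;> field_simp <;> ring

lemma HasFDerivAt.covector_const_mul (hu : HasFDerivAt u (covector a b) p) (k : ℝ) :
    HasFDerivAt (fun p => k * u p) (covector (fun i => k * a i) (k * b)) p :=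
  HasFDerivAt.covector_comp (F := fun y => k * y)
    (by simpa using (hasDerivAt_id (u p)).const_mul k) hu

lemma hasFDerivAt_time (p : Space × ℝ) :
    HasFDerivAt (fun p : Space × ℝ => p.2) (covector (fun _ => 0) 1) p := by
  convert! (hasFDerivAt_snd (𝕜 := ℝ) (p := p)) using 1
  ext w
  all_goals simp [covector_apply]

lemma hasFDerivAt_coord (r : Space) (i : Fin 3) (p : Space × ℝ) :
    HasFDerivAt (fun p : Space × ℝ => (p.1 - r) i) (covector (fun j => if i = j then 1 else 0) 0)
      p := by
  have h : HasFDerivAt (fun p : Space × ℝ => (p.1 - r) i)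
      ((EuclideanSpace.proj i : Space →L[ℝ] ℝ).comp (ContinuousLinearMap.fst ℝ Space ℝ)) p :=
    (EuclideanSpace.proj i : Space →L[ℝ] ℝ).hasFDerivAt.comp p (hasFDerivAt_fst.sub_const r)
  convert! h using 1
  ext w
  all_goals simp [covector_apply]

lemma norm_sq_eq_sum (s : Space) : ‖s‖ ^ 2 = s 0 ^ 2 + s 1 ^ 2 + s 2 ^ 2 := by
  rw [EuclideanSpace.norm_sq_eq]
  simp [Fin.sum_univ_three]

lemma hasFDerivAt_dist {r : Space} (h : p.1 ≠ r) :
    HasFDerivAt (fun p : Space × ℝ => ‖p.1 - r‖)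
      (covector (fun i => (p.1 - r) i / ‖p.1 - r‖) 0) p := by
  have h0 : 0 < ‖p.1 - r‖ := norm_pos_iff.2 (sub_ne_zero.2 h)
  have e : (fun p : Space × ℝ => ‖p.1 - r‖) = fun p : Space × ℝ =>
      √((p.1 - r) 0 * (p.1 - r) 0 + (p.1 - r) 1 * (p.1 - r) 1 + (p.1 - r) 2 * (p.1 - r) 2) := by
    ext p
    rw [← Real.sqrt_sq (norm_nonneg (p.1 - r)), norm_sq_eq_sum]
    congr 1
    ring
  have e' := congrFun e p
  simp only at e'
  have hq : HasFDerivAt (fun p : Space × ℝ =>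
      (p.1 - r) 0 * (p.1 - r) 0 + (p.1 - r) 1 * (p.1 - r) 1 + (p.1 - r) 2 * (p.1 - r) 2)
      (covector (fun i => 2 * (p.1 - r) i) 0) p := by
    have hi := fun i => HasFDerivAt.covector_mul (hasFDerivAt_coord r i p) (hasFDerivAt_coord r i p)
    convert! ((hi 0).add (hi 1)).add (hi 2) using 1
    ext w
    all_goals simp [covector_apply, Fin.sum_univ_three]
    ring
  have hs := HasFDerivAt.covector_comp (Real.hasDerivAt_sqrt
    (fun h1 => by rw [h1, Real.sqrt_zero] at e'; exact h0.ne' e')) hq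
  rw [← e'] at hs
  rw [e]
  refine HasFDerivAt.covector_congr hs (fun i => ?_) (by simp)
  field_simp

lemma hasFDerivAt_retardedTime (c : ℝ) {r : Space} (h : p.1 ≠ r) :
    HasFDerivAt (fun p : Space × ℝ => p.2 - ‖p.1 - r‖ / c)
      (covector (fun i => -((p.1 - r) i / ‖p.1 - r‖ / c)) 1) p := by
  refine HasFDerivAt.covector_congr (HasFDerivAt.covector_sub (hasFDerivAt_time p)
    ((HasFDerivAt.covector_const_mul (hasFDerivAt_dist h) c⁻¹).congr_of_eventuallyEq
      (Eventually.of_forall fun p => by simp only; rw [div_eq_inv_mul]))) (fun i => ?_) (by simp)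
  rw [zero_sub, div_eq_inv_mul _ c]

lemma abs_coord_div_norm_le (s : Space) (i : Fin 3) : |s i / ‖s‖| ≤ 1 := by
  rw [abs_div, abs_norm]
  exact div_le_one_of_le₀ (by simpa using PiLp.norm_apply_le s i) (norm_nonneg _)

end Calculus

/-! ### Delayed kernels -/

/-- The kernel of a delayed potential. -/
noncomputable def delayedKernel (c : ℝ) (f : Space → ℝ → ℝ) (p : Space × ℝ) (r : Space) : ℝ :=
  f r (p.2 - ‖p.1 - r‖ / c) / ‖p.1 - r‖

/-- The spatial derivative of the kernel of a delayed potential; `f₁` is the time derivative of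
`f`. -/
noncomputable def delayedKernelDeriv (c : ℝ) (f f₁ : Space → ℝ → ℝ) (i : Fin 3) (p : Space × ℝ)
    (r : Space) : ℝ :=
  (-(f₁ r (p.2 - ‖p.1 - r‖ / c)) / c / ‖p.1 - r‖ - f r (p.2 - ‖p.1 - r‖ / c) / ‖p.1 - r‖ ^ 2) *
    ((p.1 - r) i / ‖p.1 - r‖)

/-- `f` is measurable, continuous in time and bounded by the weight `M` for almost all points. -/
structure WeightBounded (M : Space → ℝ) (f : Space → ℝ → ℝ) : Prop where
  measurable : Measurable fun z : Space × ℝ => f z.1 z.2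
  continuous_time : ∀ᵐ r, Continuous (f r)
  bound : ∀ᵐ r, ∀ t, |f r t| ≤ M r

section DelayedKernels

variable {M : Space → ℝ} {c : ℝ} {f f₁ f₂ : Space → ℝ → ℝ}

lemma WeightBounded.isKernel (hf : WeightBounded M f) :
    IsKernel M (delayedKernel c f) where
  measurable := by
    refine Measurable.div (hf.measurable.comp (f := fun z : (Space × ℝ) × Space =>
      (z.2, z.1.2 - ‖z.1.1 - z.2‖ / c)) (by fun_prop)) (by fun_prop)
  dominated p₀ := by
    refine ⟨1, zero_le_one, ?_⟩
    filter_upwards [hf.bound] with r hr p hp hne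
    rw [delayedKernel, abs_div, abs_norm, one_mul]
    refine (div_le_div_of_nonneg_right (hr _) (norm_nonneg _)).trans ?_
    exact le_add_of_nonneg_left (indicator_nonneg (fun _ _ => by positivity) _)
  continuousAt := by
    filter_upwards [hf.continuous_time] with r hr p hne
    have h0 : ‖p.1 - r‖ ≠ 0 := norm_ne_zero_iff.2 (sub_ne_zero.2 hne)
    unfold delayedKernel
    fun_prop (disch := assumption)

/-- The term `f / d²` cannot be estimated near the diagonal by `M r / d²`, which need not be
integrable. Joint continuity of `f` on a compact set gives a bound by a constant instead. -/
lemma exists_bound_delayed (hf : Continuous fun z : Space × ℝ => f z.1 z.2) (c : ℝ)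
    (p₀ : Space × ℝ) : ∃ C, 0 ≤ C ∧ ∀ r ∈ ball p₀.1 2, ∀ p ∈ ball p₀ 1,
      |f r (p.2 - ‖p.1 - r‖ / c)| ≤ C := by
  have hK : IsCompact (closedBall p₀.1 2 ×ˢ closedBall p₀ 1) :=
    (isCompact_closedBall _ _).prod (isCompact_closedBall _ _)
  have hc : Continuous fun z : Space × (Space × ℝ) => f z.1 (z.2.2 - ‖z.2.1 - z.1‖ / c) :=
    hf.comp (f := fun z : Space × (Space × ℝ) => (z.1, z.2.2 - ‖z.2.1 - z.1‖ / c)) (by fun_prop)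
  obtain ⟨C, hC⟩ := hK.exists_bound_of_continuousOn hc.continuousOn
  refine ⟨|C|, abs_nonneg _, fun r hr p hp => ?_⟩
  exact (hC (r, p) ⟨ball_subset_closedBall hr, ball_subset_closedBall hp⟩).trans (le_abs_self C)

lemma WeightBounded.isKernel_deriv (hc : 0 < c) (hM : KatoWeight M) (hf : WeightBounded M f)
    (hf₁ : WeightBounded M f₁) (hcont : Continuous fun z : Space × ℝ => f z.1 z.2) (i : Fin 3) :
    IsKernel M (delayedKernelDeriv c f f₁ i) where
  measurable := by
    have h := hf.measurable.comp (f := fun z : (Space × ℝ) × Space =>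
      (z.2, z.1.2 - ‖z.1.1 - z.2‖ / c)) (by fun_prop)
    have h₁ := hf₁.measurable.comp (f := fun z : (Space × ℝ) × Space =>
      (z.2, z.1.2 - ‖z.1.1 - z.2‖ / c)) (by fun_prop)
    exact (((h₁.neg.div_const c).div (by fun_prop)).sub (h.div (by fun_prop))).mul (by fun_prop)
  dominated p₀ := by
    obtain ⟨C, hC, hCb⟩ := exists_bound_delayed hcont c p₀
    refine ⟨1 / c + C + 1, by positivity, ?_⟩
    filter_upwards [hf.bound, hf₁.bound] with r hr hr₁ p hp hne
    have h0 : 0 < ‖p.1 - r‖ := norm_pos_iff.2 (sub_ne_zero.2 hne)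
    have hMr := hM.nonneg r
    rw [delayedKernelDeriv, abs_mul]
    refine (mul_le_of_le_one_right (abs_nonneg _) (abs_coord_div_norm_le _ i)).trans ?_
    refine (abs_sub _ _).trans ?_
    have e1 : |-(f₁ r (p.2 - ‖p.1 - r‖ / c)) / c / ‖p.1 - r‖| ≤ 1 / c * (M r / ‖p.1 - r‖) := by
      rw [abs_div, abs_div, abs_neg, abs_norm, abs_of_pos hc, one_div, ← mul_div_assoc,
        ← div_eq_inv_mul]
      gcongr
      exact hr₁ _
    have e2 : |f r (p.2 - ‖p.1 - r‖ / c) / ‖p.1 - r‖ ^ 2| ≤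
        C * (ball p₀.1 2).indicator (fun r => 1 / ‖p.1 - r‖ ^ 2) r + M r / ‖p.1 - r‖ := by
      rw [abs_div, abs_of_nonneg (sq_nonneg ‖p.1 - r‖)]
      by_cases hrb : r ∈ ball p₀.1 2
      · rw [indicator_of_mem hrb, mul_one_div]
        refine le_add_of_le_of_nonneg ?_ (by positivity)
        gcongr
        exact hCb r hrb p hp
      · rw [indicator_of_notMem hrb, mul_zero, zero_add]
        -- The radius 2 in `kernelBound` serves this purpose: `p` is within 1 of `p₀`, so beyond
        -- that ball `d ≥ 1` and the `d⁻²` term is absorbed by `M r / d`.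
        have h1 : 1 ≤ ‖p.1 - r‖ := by
          have hp1 := mem_ball.1 (mem_ball_fst hp)
          rw [mem_ball, not_lt] at hrb
          have := dist_triangle_left r p₀.1 p.1
          rw [← dist_eq_norm]
          linarith
        rw [div_le_div_iff₀ (by positivity) h0, sq, ← mul_assoc]
        refine mul_le_mul_of_nonneg_right ?_ h0.le
        nlinarith [hr (p.2 - ‖p.1 - r‖ / c), mul_le_mul_of_nonneg_left h1 hMr]
    have e3 : 0 ≤ (ball p₀.1 2).indicator (fun r => 1 / ‖p.1 - r‖ ^ 2) r :=
      indicator_nonneg (fun _ _ => by positivity) _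
    have e4 : 0 ≤ M r / ‖p.1 - r‖ := by positivity
    unfold kernelBound
    have : 0 < 1 / c := by positivity
    nlinarith [mul_nonneg this.le e3, mul_nonneg hC e4]
  continuousAt := by
    filter_upwards [hf.continuous_time, hf₁.continuous_time] with r hr hr₁ p hne
    have h0 : ‖p.1 - r‖ ≠ 0 := norm_ne_zero_iff.2 (sub_ne_zero.2 hne)
    have h2 : ‖p.1 - r‖ ^ 2 ≠ 0 := pow_ne_zero 2 h0
    have h3 : c ≠ 0 := hc.ne'
    unfold delayedKernelDeriv
    fun_prop (disch := assumption)

lemma hasFDerivAt_delayedKernel (hc : 0 < c) {r : Space}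
    (hd : ∀ t, HasDerivAt (f r) (f₁ r t) t) {p : Space × ℝ} (hne : p.1 ≠ r) :
    HasFDerivAt (fun p => delayedKernel c f p r)
      (covector (fun i => delayedKernelDeriv c f f₁ i p r) (delayedKernel c f₁ p r)) p := by
  have h0 : ‖p.1 - r‖ ≠ 0 := norm_ne_zero_iff.2 (sub_ne_zero.2 hne)
  refine HasFDerivAt.covector_congr (HasFDerivAt.covector_div
    (HasFDerivAt.covector_comp (hd _) (hasFDerivAt_retardedTime c hne))
    (hasFDerivAt_dist hne) h0) (fun i => ?_) ?_
  · unfold delayedKernelDeriv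
    field_simp
  · unfold delayedKernel
    field_simp
    simp

/-- The potential of a source with weighted time derivative is continuously differentiable. -/
lemma hasPartials_delayed (hc : 0 < c) (hM : KatoWeight M) (hf : WeightBounded M f)
    (hf₁ : WeightBounded M f₁) (hcont : Continuous fun z : Space × ℝ => f z.1 z.2)
    (hd : ∀ᵐ r, ∀ t, HasDerivAt (f r) (f₁ r t) t) :
    HasPartials (fun p => ∫ r, delayedKernel c f p r)
      (fun i p => ∫ r, delayedKernelDeriv c f f₁ i p r) (fun p => ∫ r, delayedKernel c f₁ p r) := by
  refine hf.isKernel.hasPartials_integral hM (fun i => hf.isKernel_deriv hc hM hf₁ hcont i)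
    hf₁.isKernel ?_
  filter_upwards [hd] with r hr p hne
  exact hasFDerivAt_delayedKernel hc hr hne

end DelayedKernels

/-! ### The regularized kernel -/

/-- A radial cut-off function of class `C²`. -/
noncomputable def radialCutoff (d : ℝ) : ℝ := max 0 (1 - d) ^ 3

/-- The derivative of `radialCutoff`. -/
noncomputable def radialCutoff₁ (d : ℝ) : ℝ := -(3 * max 0 (1 - d) ^ 2)

/-- The second derivative of `radialCutoff`. -/
noncomputable def radialCutoff₂ (d : ℝ) : ℝ := 6 * max 0 (1 - d)

/-- Only `d = 1` is delicate. There `|max 0 (1 - y)| ≤ |1 - y|`, so the truncated power inherits the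
vanishing derivative of the full power, whose exponent is at least 2. -/
lemma hasDerivAt_max_pow (n : ℕ) (d : ℝ) :
    HasDerivAt (fun d : ℝ => max 0 (1 - d) ^ (n + 2)) (-((n + 2) * max 0 (1 - d) ^ (n + 1))) d := by
  have hl : HasDerivAt (fun d : ℝ => (1 - d) ^ (n + 2)) (-((n + 2) * (1 - d) ^ (n + 1))) d := by
    convert! ((hasDerivAt_id d).const_sub 1).pow (n + 2) using 1
    simp
  rcases lt_trichotomy d 1 with h | h | h
  · rw [max_eq_right (by linarith)]
    refine hl.congr_of_eventuallyEq ?_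
    filter_upwards [gt_mem_nhds h] with y hy
    rw [max_eq_right (by linarith)]
  · subst h
    simp only [sub_self, max_self, ne_eq, Nat.add_eq_zero_iff, one_ne_zero, and_false,
      not_false_eq_true, zero_pow, mul_zero, neg_zero]
    have h2 : HasDerivAt (fun d : ℝ => (1 - d) ^ (n + 2)) 0 1 := by simpa using hl
    rw [hasDerivAt_iff_isLittleO] at h2 ⊢
    refine Asymptotics.IsBigO.trans_isLittleO (Asymptotics.IsBigO.of_bound 1 ?_) h2
    filter_upwards with y
    simp only [sub_self, max_self, ne_eq, Nat.add_eq_zero_iff, OfNat.ofNat_ne_zero, and_false,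
      not_false_eq_true, zero_pow, sub_zero, smul_zero, norm_pow, Real.norm_eq_abs, one_mul]
    refine pow_le_pow_left₀ (abs_nonneg _) ?_ _
    rw [abs_of_nonneg (le_max_left 0 (1 - y))]
    exact max_le (abs_nonneg _) (le_abs_self _)
  · rw [max_eq_left (by linarith)]
    simp only [ne_eq, Nat.add_eq_zero_iff, one_ne_zero, and_false, not_false_eq_true, zero_pow,
      mul_zero, neg_zero]
    refine (hasDerivAt_const d (0 : ℝ)).congr_of_eventuallyEq ?_
    filter_upwards [lt_mem_nhds h] with y hy
    rw [max_eq_left (by linarith)]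
    simp

lemma hasDerivAt_radialCutoff (d : ℝ) : HasDerivAt radialCutoff (radialCutoff₁ d) d := by
  convert! hasDerivAt_max_pow 1 d using 1
  simp [radialCutoff₁]
  norm_num

lemma hasDerivAt_radialCutoff₁ (d : ℝ) : HasDerivAt radialCutoff₁ (radialCutoff₂ d) d := by
  convert! ((hasDerivAt_max_pow 0 d).const_mul 3).neg using 1
  simp [radialCutoff₂]
  ring

@[fun_prop]
lemma continuous_radialCutoff : Continuous radialCutoff := by unfold radialCutoff; fun_prop

@[fun_prop]
lemma continuous_radialCutoff₁ : Continuous radialCutoff₁ := by unfold radialCutoff₁; fun_prop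

@[fun_prop]
lemma continuous_radialCutoff₂ : Continuous radialCutoff₂ := by unfold radialCutoff₂; fun_prop

lemma max_zero_one_sub_mem {d : ℝ} (hd : 0 ≤ d) : 0 ≤ max 0 (1 - d) ∧ max 0 (1 - d) ≤ 1 :=
  ⟨le_max_left _ _, max_le zero_le_one (by linarith)⟩

lemma abs_radialCutoff_le {d : ℝ} (hd : 0 ≤ d) : |radialCutoff d| ≤ 1 := by
  obtain ⟨h0, h1⟩ := max_zero_one_sub_mem hd
  rw [radialCutoff, abs_of_nonneg (by positivity)]
  exact pow_le_one₀ h0 h1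

lemma abs_radialCutoff₁_le {d : ℝ} (hd : 0 ≤ d) : |radialCutoff₁ d| ≤ 3 := by
  obtain ⟨h0, h1⟩ := max_zero_one_sub_mem hd
  rw [radialCutoff₁, abs_neg, abs_of_nonneg (by positivity)]
  nlinarith [pow_le_one₀ h0 h1 (n := 2)]

lemma abs_radialCutoff₂_le {d : ℝ} (hd : 0 ≤ d) : |radialCutoff₂ d| ≤ 6 := by
  obtain ⟨h0, h1⟩ := max_zero_one_sub_mem hd
  rw [radialCutoff₂, abs_of_nonneg (by positivity)]
  linarith

lemma radialCutoff_of_one_le {d : ℝ} (hd : 1 ≤ d) : radialCutoff d = 0 := by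
  rw [radialCutoff, max_eq_left (by linarith)]; simp

lemma radialCutoff₁_of_one_le {d : ℝ} (hd : 1 ≤ d) : radialCutoff₁ d = 0 := by
  rw [radialCutoff₁, max_eq_left (by linarith)]; simp

lemma radialCutoff₂_of_one_le {d : ℝ} (hd : 1 ≤ d) : radialCutoff₂ d = 0 := by
  rw [radialCutoff₂, max_eq_left (by linarith)]; simp

lemma radialCutoff_zero : radialCutoff 0 = 1 := by simp [radialCutoff]

/-! ### Taylor estimates in the distance variable. -/

section OneDim

variable {F F₁ F₂ : ℝ → ℝ} {c m t d : ℝ}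

lemma hasDerivAt_retarded (hF : ∀ t, HasDerivAt F (F₁ t) t) (c t d : ℝ) :
    HasDerivAt (fun d => F (t - d / c)) (-(F₁ (t - d / c)) / c) d := by
  have h : HasDerivAt (fun d => t - d / c) (-(1 / c)) d :=
    ((hasDerivAt_id d).div_const c).const_sub t
  convert! (hF (t - d / c)).comp d h using 1
  ring

lemma hasDerivAt_retarded_sub (hF : ∀ t, HasDerivAt F (F₁ t) t) (c t d : ℝ) :
    HasDerivAt (fun d => F (t - d / c) - radialCutoff d * F t)
      (-(F₁ (t - d / c)) / c - radialCutoff₁ d * F t) d :=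
  (hasDerivAt_retarded hF c t d).sub ((hasDerivAt_radialCutoff d).mul_const _)

lemma hasDerivAt_retarded_sub₁ (hF₁ : ∀ t, HasDerivAt F₁ (F₂ t) t) (c t d : ℝ) :
    HasDerivAt (fun d => -(F₁ (t - d / c)) / c - radialCutoff₁ d * F t)
      (F₂ (t - d / c) / c ^ 2 - radialCutoff₂ d * F t) d := by
  convert! ((hasDerivAt_retarded hF₁ c t d).neg.div_const c).sub
    ((hasDerivAt_radialCutoff₁ d).mul_const (F t)) using 1
  ring

lemma abs_retarded_deriv_le (hc : 0 < c) (hd : 0 ≤ d) (hm : ∀ t, |F t| ≤ m)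
    (hm₁ : ∀ t, |F₁ t| ≤ m) :
    |-(F₁ (t - d / c)) / c - radialCutoff₁ d * F t| ≤ (1 / c + 3) * m := by
  refine (abs_sub _ _).trans ?_
  rw [abs_div, abs_neg, abs_mul, abs_of_pos hc, add_mul, one_div, ← div_eq_inv_mul]
  gcongr
  · exact hm₁ _
  · exact abs_radialCutoff₁_le hd
  · exact hm _

lemma abs_retarded_deriv₂_le (hc : 0 < c) (hd : 0 ≤ d) (hm : ∀ t, |F t| ≤ m)
    (hm₂ : ∀ t, |F₂ t| ≤ m) :
    |F₂ (t - d / c) / c ^ 2 - radialCutoff₂ d * F t| ≤ (1 / c ^ 2 + 6) * m := by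
  refine (abs_sub _ _).trans ?_
  rw [abs_div, abs_mul, abs_of_pos (by positivity : 0 < c ^ 2), add_mul, one_div, ← div_eq_inv_mul]
  gcongr
  · exact hm₂ _
  · exact abs_radialCutoff₂_le hd
  · exact hm _

/-- Mean value inequality on `[0, d]`: the difference vanishes at distance zero because `ζ(0) = 1`.
-/
lemma abs_retarded_sub_le (hc : 0 < c) (hd : 0 ≤ d) (hF : ∀ t, HasDerivAt F (F₁ t) t)
    (hm : ∀ t, |F t| ≤ m) (hm₁ : ∀ t, |F₁ t| ≤ m) :
    |F (t - d / c) - radialCutoff d * F t| ≤ (1 / c + 3) * m * d := by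
  have h := norm_image_sub_le_of_norm_deriv_le_segment' (a := 0) (b := d)
    (f := fun d => F (t - d / c) - radialCutoff d * F t) (C := (1 / c + 3) * m)
    (fun x _ => (hasDerivAt_retarded_sub hF c t x).hasDerivWithinAt)
    (fun x hx => abs_retarded_deriv_le hc hx.1 hm hm₁) d ⟨hd, le_rfl⟩
  simpa [radialCutoff_zero] using h

/-- With `h(d) = F (t - d / c) - ζ(d) F t`, the function `d h' - h` vanishes at zero and has
derivative `d h''`. The terms in `h'` cancel, so only bounds on `F` and `F₂` enter. -/
lemma abs_retarded_taylor_le (hc : 0 < c) (hd : 0 ≤ d) (hF : ∀ t, HasDerivAt F (F₁ t) t)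
    (hF₁ : ∀ t, HasDerivAt F₁ (F₂ t) t) (hm : ∀ t, |F t| ≤ m) (hm₂ : ∀ t, |F₂ t| ≤ m) :
    |d * (-(F₁ (t - d / c)) / c - radialCutoff₁ d * F t) -
      (F (t - d / c) - radialCutoff d * F t)| ≤ (1 / c ^ 2 + 6) * m * d ^ 2 := by
  have h := norm_image_sub_le_of_norm_deriv_le_segment' (a := 0) (b := d)
    (f := fun d => d * (-(F₁ (t - d / c)) / c - radialCutoff₁ d * F t) -
      (F (t - d / c) - radialCutoff d * F t)) (C := d * ((1 / c ^ 2 + 6) * m))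
    (fun x _ => ((((hasDerivAt_id x).mul (hasDerivAt_retarded_sub₁ (F := F) hF₁ c t x))).sub
      (hasDerivAt_retarded_sub hF c t x)).hasDerivWithinAt)
    (fun x hx => ?_) d ⟨hd, le_rfl⟩
  · simp only [zero_div, sub_zero, zero_mul, radialCutoff_zero, one_mul, sub_self] at h
    refine h.trans (le_of_eq (by ring))
  · simp only [id, one_mul, add_sub_cancel_left]
    rw [Real.norm_eq_abs, abs_mul, abs_of_nonneg hx.1]
    exact mul_le_mul hx.2.le (abs_retarded_deriv₂_le hc hx.1 hm hm₂) (abs_nonneg _) hd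

end OneDim

/-- The radial derivative of the regularized kernel `(f(r, t - d/c) - ζ(d) f(r, t)) / d`, where
`ζ` is the radial cut-off function. -/
noncomputable def regDeriv (c : ℝ) (f f₁ : Space → ℝ → ℝ) (p : Space × ℝ) (r : Space) : ℝ :=
  ((-(f₁ r (p.2 - ‖p.1 - r‖ / c)) / c - radialCutoff₁ ‖p.1 - r‖ * f r p.2) -
    (f r (p.2 - ‖p.1 - r‖ / c) - radialCutoff ‖p.1 - r‖ * f r p.2) / ‖p.1 - r‖) / ‖p.1 - r‖

/-- The second radial derivative of the regularized kernel. -/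
noncomputable def regDeriv₂ (c : ℝ) (f f₁ f₂ : Space → ℝ → ℝ) (p : Space × ℝ) (r : Space) : ℝ :=
  ((f₂ r (p.2 - ‖p.1 - r‖ / c) / c ^ 2 - radialCutoff₂ ‖p.1 - r‖ * f r p.2) -
    2 * regDeriv c f f₁ p r) / ‖p.1 - r‖

/-- The spatial gradient of the regularized kernel. -/
noncomputable def regGrad (c : ℝ) (f f₁ : Space → ℝ → ℝ) (i : Fin 3) (p : Space × ℝ)
    (r : Space) : ℝ :=
  regDeriv c f f₁ p r * ((p.1 - r) i / ‖p.1 - r‖)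

/-- The spatial Hessian of the regularized kernel. -/
noncomputable def regHess (c : ℝ) (f f₁ f₂ : Space → ℝ → ℝ) (i j : Fin 3) (p : Space × ℝ)
    (r : Space) : ℝ :=
  regDeriv₂ c f f₁ f₂ p r * ((p.1 - r) j / ‖p.1 - r‖) * ((p.1 - r) i / ‖p.1 - r‖) +
    regDeriv c f f₁ p r * (((if i = j then 1 else 0) -
      (p.1 - r) i / ‖p.1 - r‖ * ((p.1 - r) j / ‖p.1 - r‖)) / ‖p.1 - r‖)

section RegularizedKernel

variable {M : Space → ℝ} {c : ℝ} {f f₁ f₂ : Space → ℝ → ℝ}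

/-- With `q = h / d` the radial profile, `h = d q` gives `h'' = d q'' + 2 q'`, which is the form
chosen for `regDeriv₂`. The time derivative replaces `f, f₁` by `f₁, f₂`. -/
lemma hasFDerivAt_regDeriv (hc : 0 < c) {r : Space} (hd : ∀ t, HasDerivAt (f r) (f₁ r t) t)
    (hd₁ : ∀ t, HasDerivAt (f₁ r) (f₂ r t) t) {p : Space × ℝ} (hne : p.1 ≠ r) :
    HasFDerivAt (fun p => regDeriv c f f₁ p r)
      (covector (fun i => regDeriv₂ c f f₁ f₂ p r * ((p.1 - r) i / ‖p.1 - r‖))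
        (regDeriv c f₁ f₂ p r)) p := by
  have h0 : ‖p.1 - r‖ ≠ 0 := norm_ne_zero_iff.2 (sub_ne_zero.2 hne)
  have hD := hasFDerivAt_dist hne
  have hq := hasFDerivAt_retardedTime c hne
  have hF := HasFDerivAt.covector_comp (hd _) hq
  have hF₁ := HasFDerivAt.covector_comp (hd₁ _) hq
  have hFt := HasFDerivAt.covector_comp (hd p.2) (hasFDerivAt_time p)
  have hz := HasFDerivAt.covector_comp (hasDerivAt_radialCutoff _) hD
  have hz₁ := HasFDerivAt.covector_comp (hasDerivAt_radialCutoff₁ _) hD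
  have h := HasFDerivAt.covector_div (HasFDerivAt.covector_sub
    (HasFDerivAt.covector_sub (HasFDerivAt.covector_const_mul hF₁ (-1 / c))
      (HasFDerivAt.covector_mul hz₁ hFt))
    (HasFDerivAt.covector_div (HasFDerivAt.covector_sub hF (HasFDerivAt.covector_mul hz hFt))
      hD h0)) hD h0
  have e : (fun p => regDeriv c f f₁ p r) = fun p =>
      (-1 / c * f₁ r (p.2 - ‖p.1 - r‖ / c) - radialCutoff₁ ‖p.1 - r‖ * f r p.2 -
      (f r (p.2 - ‖p.1 - r‖ / c) - radialCutoff ‖p.1 - r‖ * f r p.2) / ‖p.1 - r‖) /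
        ‖p.1 - r‖ := by
    ext p
    rw [regDeriv]
    ring
  rw [e]
  refine HasFDerivAt.covector_congr h (fun i => ?_) ?_
  · simp only [regDeriv₂, regDeriv]
    field_simp
    ring
  · simp only [regDeriv]
    field_simp
    ring

lemma hasFDerivAt_regGrad (hc : 0 < c) {r : Space} (hd : ∀ t, HasDerivAt (f r) (f₁ r t) t)
    (hd₁ : ∀ t, HasDerivAt (f₁ r) (f₂ r t) t) (i : Fin 3) {p : Space × ℝ} (hne : p.1 ≠ r) :
    HasFDerivAt (fun p => regGrad c f f₁ i p r)
      (covector (fun j => regHess c f f₁ f₂ i j p r) (regGrad c f₁ f₂ i p r)) p := by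
  have h0 : ‖p.1 - r‖ ≠ 0 := norm_ne_zero_iff.2 (sub_ne_zero.2 hne)
  refine HasFDerivAt.covector_congr (HasFDerivAt.covector_mul (hasFDerivAt_regDeriv hc hd hd₁ hne)
    (HasFDerivAt.covector_div (hasFDerivAt_coord r i p) (hasFDerivAt_dist hne) h0))
    (fun j => ?_) ?_
  · simp only [regHess]
  · simp only [regGrad]
    simp

/-- The trace of the Hessian. -/
lemma sum_regHess {p : Space × ℝ} {r : Space} (hne : p.1 ≠ r) :
    ∑ i, regHess c f f₁ f₂ i i p r =
      (f₂ r (p.2 - ‖p.1 - r‖ / c) / c ^ 2 - radialCutoff₂ ‖p.1 - r‖ * f r p.2) / ‖p.1 - r‖ := by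
  have h0 : ‖p.1 - r‖ ≠ 0 := norm_ne_zero_iff.2 (sub_ne_zero.2 hne)
  have h1 := norm_sq_eq_sum (p.1 - r)
  have h2 : ((p.1 - r) 0 / ‖p.1 - r‖) ^ 2 + ((p.1 - r) 1 / ‖p.1 - r‖) ^ 2 +
      ((p.1 - r) 2 / ‖p.1 - r‖) ^ 2 = 1 := by
    rw [div_pow, div_pow, div_pow, ← add_div, ← add_div, ← h1]
    exact div_self (pow_ne_zero 2 h0)
  simp only [Fin.sum_univ_three, regHess, if_true]
  generalize (p.1 - r) 0 / ‖p.1 - r‖ = x at *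
  generalize (p.1 - r) 1 / ‖p.1 - r‖ = y at *
  generalize (p.1 - r) 2 / ‖p.1 - r‖ = z at *
  have e : regDeriv₂ c f f₁ f₂ p r * x * x + regDeriv c f f₁ p r * ((1 - x * x) / ‖p.1 - r‖) +
      (regDeriv₂ c f f₁ f₂ p r * y * y + regDeriv c f f₁ p r * ((1 - y * y) / ‖p.1 - r‖)) +
      (regDeriv₂ c f f₁ f₂ p r * z * z + regDeriv c f f₁ p r * ((1 - z * z) / ‖p.1 - r‖)) =
      regDeriv₂ c f f₁ f₂ p r * (x ^ 2 + y ^ 2 + z ^ 2) +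
        regDeriv c f f₁ p r * (3 - (x ^ 2 + y ^ 2 + z ^ 2)) / ‖p.1 - r‖ := by ring
  -- The direction cosines have square sum one, so the trace is the radial Laplacian `q'' + 2 q' / d
  -- = h'' / d`.
  rw [e, h2, regDeriv₂]
  field_simp
  ring

/-- The regularized kernel accounts for the delayed kernel up to a static kernel. -/
lemma delayedKernelDeriv_eq (i : Fin 3) (p : Space × ℝ) (r : Space) :
    delayedKernelDeriv c f f₁ i p r = regGrad c f f₁ i p r +
      f r p.2 * ((radialCutoff₁ ‖p.1 - r‖ / ‖p.1 - r‖ - radialCutoff ‖p.1 - r‖ / ‖p.1 - r‖ ^ 2) *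
        ((p.1 - r) i / ‖p.1 - r‖)) := by
  unfold delayedKernelDeriv regGrad regDeriv
  ring

/-! ### Estimates for the derivatives of the regularized kernel. -/

section Bounds

variable {r : Space} {p : Space × ℝ}

/-- The profile derivative is `(h' - h / d) / d`; both `h'` and `h / d` are at most `(1 / c + 3) * M
r`. Only one time derivative is used, so the estimate also serves the pair `f₁, f₂`, for which no
third derivative is available. -/
lemma abs_regDeriv_le (hc : 0 < c) (hd : ∀ t, HasDerivAt (f r) (f₁ r t) t)
    (hm : ∀ t, |f r t| ≤ M r) (hm₁ : ∀ t, |f₁ r t| ≤ M r) (hne : p.1 ≠ r) :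
    |regDeriv c f f₁ p r| ≤ 2 * (1 / c + 3) * (M r / ‖p.1 - r‖) := by
  have h0 : 0 < ‖p.1 - r‖ := norm_pos_iff.2 (sub_ne_zero.2 hne)
  rw [regDeriv, abs_div, abs_norm, ← mul_div_assoc]
  gcongr
  refine (abs_sub _ _).trans ?_
  have e1 := abs_retarded_deriv_le (t := p.2) hc h0.le hm hm₁
  have e2 := abs_retarded_sub_le (t := p.2) hc h0.le hd hm hm₁
  rw [← div_le_iff₀ h0] at e2
  rw [abs_div, abs_norm]
  linarith

/-- Writing the profile derivative as `(d h' - h) / d²`, the Taylor estimate removes the singularity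
completely. This spare power of `d` makes the Hessian integrable. -/
lemma abs_regDeriv_le' (hc : 0 < c) (hd : ∀ t, HasDerivAt (f r) (f₁ r t) t)
    (hd₁ : ∀ t, HasDerivAt (f₁ r) (f₂ r t) t)
    (hm : ∀ t, |f r t| ≤ M r) (hm₂ : ∀ t, |f₂ r t| ≤ M r) (hne : p.1 ≠ r) :
    |regDeriv c f f₁ p r| ≤ (1 / c ^ 2 + 6) * M r := by
  have h0 : 0 < ‖p.1 - r‖ := norm_pos_iff.2 (sub_ne_zero.2 hne)
  have e := abs_retarded_taylor_le (t := p.2) hc h0.le hd hd₁ hm hm₂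
  have : regDeriv c f f₁ p r = (‖p.1 - r‖ * (-(f₁ r (p.2 - ‖p.1 - r‖ / c)) / c -
      radialCutoff₁ ‖p.1 - r‖ * f r p.2) - (f r (p.2 - ‖p.1 - r‖ / c) -
      radialCutoff ‖p.1 - r‖ * f r p.2)) / ‖p.1 - r‖ ^ 2 := by
    unfold regDeriv
    field_simp
  rw [this, abs_div, abs_of_pos (by positivity : 0 < ‖p.1 - r‖ ^ 2), div_le_iff₀ (by positivity)]
  exact e

lemma abs_regDeriv₂_le (hc : 0 < c) (hd : ∀ t, HasDerivAt (f r) (f₁ r t) t)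
    (hd₁ : ∀ t, HasDerivAt (f₁ r) (f₂ r t) t)
    (hm : ∀ t, |f r t| ≤ M r) (hm₂ : ∀ t, |f₂ r t| ≤ M r) (hne : p.1 ≠ r) :
    |regDeriv₂ c f f₁ f₂ p r| ≤ 3 * (1 / c ^ 2 + 6) * (M r / ‖p.1 - r‖) := by
  have h0 : 0 < ‖p.1 - r‖ := norm_pos_iff.2 (sub_ne_zero.2 hne)
  rw [regDeriv₂, abs_div, abs_norm, ← mul_div_assoc]
  gcongr
  refine (abs_sub _ _).trans ?_
  have e1 := abs_retarded_deriv₂_le (t := p.2) hc h0.le hm hm₂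
  have e2 := abs_regDeriv_le' hc hd hd₁ hm hm₂ hne
  rw [abs_mul, abs_two]
  linarith

/-- The purely radial term contributes the factor 3; the angular term contributes 2, as the
projection coefficient is at most 2 and `abs_regDeriv_le'` leaves a single power of `1 / d`. -/
lemma abs_regHess_le (hc : 0 < c) (hd : ∀ t, HasDerivAt (f r) (f₁ r t) t)
    (hd₁ : ∀ t, HasDerivAt (f₁ r) (f₂ r t) t)
    (hm : ∀ t, |f r t| ≤ M r) (hm₂ : ∀ t, |f₂ r t| ≤ M r) (hne : p.1 ≠ r) (i j : Fin 3) :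
    |regHess c f f₁ f₂ i j p r| ≤ 5 * (1 / c ^ 2 + 6) * (M r / ‖p.1 - r‖) := by
  have h0 : 0 < ‖p.1 - r‖ := norm_pos_iff.2 (sub_ne_zero.2 hne)
  have e1 := abs_regDeriv₂_le hc hd hd₁ hm hm₂ hne
  have e2 := abs_regDeriv_le' hc hd hd₁ hm hm₂ hne
  have hi := abs_coord_div_norm_le (p.1 - r) i
  have hj := abs_coord_div_norm_le (p.1 - r) j
  have a1 : |regDeriv₂ c f f₁ f₂ p r * ((p.1 - r) j / ‖p.1 - r‖) * ((p.1 - r) i / ‖p.1 - r‖)| ≤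
      3 * (1 / c ^ 2 + 6) * (M r / ‖p.1 - r‖) := by
    rw [abs_mul, abs_mul]
    exact (mul_le_of_le_one_right (by positivity) hi).trans
      ((mul_le_of_le_one_right (abs_nonneg _) hj).trans e1)
  have a2 : |(if i = j then 1 else 0 : ℝ) -
      (p.1 - r) i / ‖p.1 - r‖ * ((p.1 - r) j / ‖p.1 - r‖)| ≤ 2 := by
    refine (abs_sub _ _).trans ?_
    rw [abs_mul]
    have : |(if i = j then 1 else 0 : ℝ)| ≤ 1 := by split_ifs <;> simp
    have := mul_le_one₀ hi (abs_nonneg _) hj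
    linarith
  rw [regHess]
  refine (abs_add_le _ _).trans ?_
  have a3 : |regDeriv c f f₁ p r * (((if i = j then 1 else 0) -
      (p.1 - r) i / ‖p.1 - r‖ * ((p.1 - r) j / ‖p.1 - r‖)) / ‖p.1 - r‖)| ≤
      2 * (1 / c ^ 2 + 6) * (M r / ‖p.1 - r‖) := by
    rw [abs_mul, abs_div, abs_norm, ← mul_div_assoc,
      show 2 * (1 / c ^ 2 + 6) * (M r / ‖p.1 - r‖) = (1 / c ^ 2 + 6) * M r * 2 / ‖p.1 - r‖ by ring]
    exact div_le_div_of_nonneg_right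
      (mul_le_mul e2 a2 (abs_nonneg _) ((abs_nonneg _).trans e2)) h0.le
  linarith

end Bounds

lemma le_kernelBound (M : Space → ℝ) (x₀ x r : Space) : M r / ‖x - r‖ ≤ kernelBound M x₀ x r :=
  le_add_of_nonneg_left (indicator_nonneg (fun _ _ => by positivity) _)

lemma WeightBounded.measurable_regDeriv (hf : WeightBounded M f) (hf₁ : WeightBounded M f₁) :
    Measurable fun z : (Space × ℝ) × Space => regDeriv c f f₁ z.1 z.2 := by
  have h := hf.measurable.comp (f := fun z : (Space × ℝ) × Space =>
    (z.2, z.1.2 - ‖z.1.1 - z.2‖ / c)) (by fun_prop)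
  have h₁ := hf₁.measurable.comp (f := fun z : (Space × ℝ) × Space =>
    (z.2, z.1.2 - ‖z.1.1 - z.2‖ / c)) (by fun_prop)
  have ht := hf.measurable.comp (f := fun z : (Space × ℝ) × Space => (z.2, z.1.2)) (by fun_prop)
  have hz : Measurable fun z : (Space × ℝ) × Space => radialCutoff ‖z.1.1 - z.2‖ :=
    continuous_radialCutoff.measurable.comp (by fun_prop)
  have hz₁ : Measurable fun z : (Space × ℝ) × Space => radialCutoff₁ ‖z.1.1 - z.2‖ :=
    continuous_radialCutoff₁.measurable.comp (by fun_prop)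
  exact ((((h₁.neg.div_const c)).sub (hz₁.mul ht)).sub
    ((h.sub (hz.mul ht)).div (by fun_prop))).div (by fun_prop)

lemma WeightBounded.isKernel_regGrad (hc : 0 < c) (hf : WeightBounded M f)
    (hf₁ : WeightBounded M f₁) (hd : ∀ᵐ r, ∀ t, HasDerivAt (f r) (f₁ r t) t) (i : Fin 3) :
    IsKernel M (regGrad c f f₁ i) where
  measurable := (hf.measurable_regDeriv hf₁).mul (by fun_prop)
  dominated p₀ := by
    refine ⟨2 * (1 / c + 3), by positivity, ?_⟩
    filter_upwards [hf.bound, hf₁.bound, hd] with r hr hr₁ hd p hp hne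
    rw [regGrad, abs_mul]
    refine (mul_le_of_le_one_right (abs_nonneg _) (abs_coord_div_norm_le _ i)).trans ?_
    refine (abs_regDeriv_le hc hd hr hr₁ hne).trans ?_
    have := le_kernelBound M p₀.1 p.1 r
    gcongr
  continuousAt := by
    filter_upwards [hf.continuous_time, hf₁.continuous_time] with r hr hr₁ p hne
    have h0 : ‖p.1 - r‖ ≠ 0 := norm_ne_zero_iff.2 (sub_ne_zero.2 hne)
    have h3 : c ≠ 0 := hc.ne'
    unfold regGrad regDeriv
    fun_prop (disch := assumption)

lemma WeightBounded.isKernel_regHess (hc : 0 < c) (hf : WeightBounded M f)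
    (hf₁ : WeightBounded M f₁) (hf₂ : WeightBounded M f₂)
    (hd : ∀ᵐ r, ∀ t, HasDerivAt (f r) (f₁ r t) t)
    (hd₁ : ∀ᵐ r, ∀ t, HasDerivAt (f₁ r) (f₂ r t) t) (i j : Fin 3) :
    IsKernel M (regHess c f f₁ f₂ i j) where
  measurable := by
    have h := hf.measurable_regDeriv (c := c) hf₁
    have h₂ := hf₂.measurable.comp (f := fun z : (Space × ℝ) × Space =>
      (z.2, z.1.2 - ‖z.1.1 - z.2‖ / c)) (by fun_prop)
    have ht := hf.measurable.comp (f := fun z : (Space × ℝ) × Space => (z.2, z.1.2)) (by fun_prop)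
    have hz₂ : Measurable fun z : (Space × ℝ) × Space => radialCutoff₂ ‖z.1.1 - z.2‖ :=
      continuous_radialCutoff₂.measurable.comp (by fun_prop)
    have h' : Measurable fun z : (Space × ℝ) × Space => regDeriv₂ c f f₁ f₂ z.1 z.2 :=
      (((h₂.div_const _).sub (hz₂.mul ht)).sub (h.const_mul 2)).div (by fun_prop)
    exact ((h'.mul (by fun_prop)).mul (by fun_prop)).add (h.mul (by fun_prop))
  dominated p₀ := by
    refine ⟨5 * (1 / c ^ 2 + 6), by positivity, ?_⟩
    filter_upwards [hf.bound, hf₂.bound, hd, hd₁] with r hr hr₂ hd hd₁ p hp hne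
    refine (abs_regHess_le hc hd hd₁ hr hr₂ hne i j).trans ?_
    have := le_kernelBound M p₀.1 p.1 r
    gcongr
  continuousAt := by
    filter_upwards [hf.continuous_time, hf₁.continuous_time, hf₂.continuous_time]
      with r hr hr₁ hr₂ p hne
    have h0 : ‖p.1 - r‖ ≠ 0 := norm_ne_zero_iff.2 (sub_ne_zero.2 hne)
    have h3 : c ≠ 0 := hc.ne'
    have h4 : c ^ 2 ≠ 0 := pow_ne_zero 2 h3
    unfold regHess regDeriv₂ regDeriv
    fun_prop (disch := assumption)

lemma hasPartials_regGrad (hc : 0 < c) (hM : KatoWeight M) (hf : WeightBounded M f)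
    (hf₁ : WeightBounded M f₁) (hf₂ : WeightBounded M f₂)
    (hd : ∀ᵐ r, ∀ t, HasDerivAt (f r) (f₁ r t) t)
    (hd₁ : ∀ᵐ r, ∀ t, HasDerivAt (f₁ r) (f₂ r t) t) (i : Fin 3) :
    HasPartials (fun p => ∫ r, regGrad c f f₁ i p r)
      (fun j p => ∫ r, regHess c f f₁ f₂ i j p r) (fun p => ∫ r, regGrad c f₁ f₂ i p r) := by
  refine (hf.isKernel_regGrad hc hf₁ hd i).hasPartials_integral hM
    (fun j => hf.isKernel_regHess hc hf₁ hf₂ hd hd₁ i j)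
    (hf₁.isKernel_regGrad hc hf₂ hd₁ i) ?_
  filter_upwards [hd, hd₁] with r hr hr₁ p hne
  exact hasFDerivAt_regGrad hc hr hr₁ i hne

end RegularizedKernel

/-! ### Convolutions with compactly supported kernels -/

section Convolution

variable {k τ : Space → ℝ} {R : ℝ}

/-- The time shift `τ` is general so that the same convolution lemmas cover the static kernel (`τ =
0`) and delayed potentials of cut-off sources (`τ s = ‖s‖ / c`). -/
lemma exists_bound_shift {V : Type*} [NormedAddCommGroup V] {g : Space × ℝ → V}
    (hg : Continuous g) (hτ : Continuous τ) (R : ℝ) (p₀ : Space × ℝ) :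
    ∃ C, ∀ p ∈ ball p₀ 1, ∀ s, ‖s‖ ≤ R → ‖g (p.1 - s, p.2 - τ s)‖ ≤ C := by
  have hK : IsCompact (closedBall p₀ 1 ×ˢ closedBall (0 : Space) R) :=
    (isCompact_closedBall _ _).prod (isCompact_closedBall _ _)
  have hc : Continuous fun z : (Space × ℝ) × Space => g (z.1.1 - z.2, z.1.2 - τ z.2) :=
    hg.comp (by fun_prop)
  obtain ⟨C, hC⟩ := hK.exists_bound_of_continuousOn hc.continuousOn
  exact ⟨C, fun p hp s hs => hC (p, s) ⟨ball_subset_closedBall hp, by simpa using hs⟩⟩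

lemma norm_smul_shift_le {V : Type*} [NormedAddCommGroup V] [NormedSpace ℝ V] {w : V} {C : ℝ}
    (hsupp : ∀ s, R ≤ ‖s‖ → k s = 0) {s : Space} (h : ‖s‖ ≤ R → ‖w‖ ≤ C) :
    ‖k s • w‖ ≤ |k s| * C := by
  rw [norm_smul, Real.norm_eq_abs]
  rcases le_or_gt R ‖s‖ with hs | hs
  · simp [hsupp s hs]
  · exact mul_le_mul_of_nonneg_left (h hs.le) (abs_nonneg _)

lemma continuous_convolution {V : Type*} [NormedAddCommGroup V] [NormedSpace ℝ V]
    [SecondCountableTopology V] (hk : Integrable k)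
    (hsupp : ∀ s, R ≤ ‖s‖ → k s = 0) (hτ : Continuous τ) {g : Space × ℝ → V}
    (hg : Continuous g) :
    Continuous fun p : Space × ℝ => ∫ s, k s • g (p.1 - s, p.2 - τ s) := by
  rw [continuous_iff_continuousAt]
  intro p₀
  obtain ⟨C, hC⟩ := exists_bound_shift hg hτ R p₀
  refine continuousAt_of_dominated (bound := fun s => |k s| * C) (Eventually.of_forall fun p => ?_)
    ?_ (hk.abs.mul_const C) (Eventually.of_forall fun s => by fun_prop)
  · exact hk.aestronglyMeasurable.smul
      (Continuous.aestronglyMeasurable (hg.comp (by fun_prop)))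
  · filter_upwards [ball_mem_nhds p₀ one_pos] with p hp
    exact Eventually.of_forall fun s => norm_smul_shift_le hsupp fun hs => hC p hp s hs

lemma integrable_convolution {V : Type*} [NormedAddCommGroup V] [NormedSpace ℝ V]
    [SecondCountableTopology V] (hk : Integrable k)
    (hsupp : ∀ s, R ≤ ‖s‖ → k s = 0) (hτ : Continuous τ) {g : Space × ℝ → V}
    (hg : Continuous g) (p : Space × ℝ) :
    Integrable fun s => k s • g (p.1 - s, p.2 - τ s) := by
  obtain ⟨C, hC⟩ := exists_bound_shift hg hτ R p
  exact (hk.abs.mul_const C).mono' (hk.aestronglyMeasurable.smul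
    (Continuous.aestronglyMeasurable (hg.comp (by fun_prop))))
    (Eventually.of_forall fun s =>
      norm_smul_shift_le hsupp fun hs => hC p (mem_ball_self one_pos) s hs)

/-- Differentiation of a convolution by differentiating the regular factor. -/
lemma HasPartials.convolution {u : Space × ℝ → ℝ} {a : Fin 3 → Space × ℝ → ℝ}
    {b : Space × ℝ → ℝ} (hu : HasPartials u a b) (hk : Integrable k)
    (hsupp : ∀ s, R ≤ ‖s‖ → k s = 0) (hτ : Continuous τ) :
    HasPartials (fun p => ∫ s, k s • u (p.1 - s, p.2 - τ s))
      (fun i p => ∫ s, k s • a i (p.1 - s, p.2 - τ s))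
      (fun p => ∫ s, k s • b (p.1 - s, p.2 - τ s)) where
  continuous_space i := continuous_convolution hk hsupp hτ (hu.continuous_space i)
  continuous_time := continuous_convolution hk hsupp hτ hu.continuous_time
  hasFDerivAt p₀ := by
    have huc : Continuous u := hu.contDiff_one.continuous
    have hL : Continuous fun p => covector (fun i => a i p) (b p) := contDiff_zero.1
      (contDiff_covector (n := 0) (fun i => contDiff_zero.2 (hu.continuous_space i))
        (contDiff_zero.2 hu.continuous_time))
    obtain ⟨C, hC⟩ := exists_bound_shift hL hτ R p₀
    have h := hasFDerivAt_integral_of_dominated_of_fderiv_le (𝕜 := ℝ) (μ := volume) (x₀ := p₀)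
      (F := fun p s => k s • u (p.1 - s, p.2 - τ s))
      (F' := fun p s => k s • covector (fun i => a i (p.1 - s, p.2 - τ s))
        (b (p.1 - s, p.2 - τ s))) (bound := fun s => |k s| * C)
      (ball_mem_nhds p₀ one_pos)
      (Eventually.of_forall fun p => (integrable_convolution hk hsupp hτ huc p).1)
      (integrable_convolution hk hsupp hτ huc p₀)
      (integrable_convolution hk hsupp hτ hL p₀).1
      (Eventually.of_forall fun s p hp => norm_smul_shift_le hsupp fun hs => hC p hp s hs)
      (hk.abs.mul_const C)
      (Eventually.of_forall fun s p _ => by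
        have hshift : HasFDerivAt (fun p : Space × ℝ => (p.1 - s, p.2 - τ s))
            (ContinuousLinearMap.id ℝ (Space × ℝ)) p := by
          have := (hasFDerivAt_id (𝕜 := ℝ) p).sub_const (s, τ s)
          exact this
        have := ((hu.hasFDerivAt (p.1 - s, p.2 - τ s)).comp p hshift).const_smul (k s)
        exact this)
    convert! h using 1
    ext v
    all_goals
      rw [ContinuousLinearMap.comp_apply, ContinuousLinearMap.comp_apply,
        ContinuousLinearMap.integral_apply (integrable_convolution hk hsupp hτ hL p₀)]
      simp only [covector_apply, smul_apply, Fin.sum_univ_three, smul_eq_mul]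
      have i0 := fun i => integrable_convolution hk hsupp hτ (hu.continuous_space i) p₀
      have i1 := integrable_convolution hk hsupp hτ hu.continuous_time p₀
      simp only [smul_eq_mul] at i0 i1
      simp only [mul_add, ← mul_assoc]
      rw [integral_add, integral_add, integral_add, integral_mul_const, integral_mul_const,
        integral_mul_const, integral_mul_const]
      all_goals
        first
        | exact (i0 _).mul_const _
        | exact i1.mul_const _
        | exact ((i0 _).mul_const _).add ((i0 _).mul_const _)
        | exact (((i0 _).mul_const _).add ((i0 _).mul_const _)).add ((i0 _).mul_const _)

end Convolution

/-! ### Polar coordinates -/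

/-- The origin is null, and its complement is identified with sphere times half-line, where volume
becomes surface measure times `y ^ 2 dy`. -/
lemma integral_polar {Q : Space → ℝ} (hQ : Integrable Q) :
    ∫ s, Q s = ∫ ω : sphere (0 : Space) 1, (∫ y in Ioi (0 : ℝ), y ^ 2 * Q (y • ω.1))
      ∂(volume : Measure Space).toSphere := by
  have hmp := (volume : Measure Space).measurePreserving_homeomorphUnitSphereProd
  have hemb := (homeomorphUnitSphereProd Space).measurableEmbedding
  have hdim : Module.finrank ℝ Space - 1 = 2 := by simp
  rw [hdim] at hmp
  set Q' : sphere (0 : Space) 1 × Ioi (0 : ℝ) → ℝ := fun z => Q (z.2.1 • z.1.1) with hQ'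
  have hcomp : Q' ∘ homeomorphUnitSphereProd Space = fun x : ({(0)}ᶜ : Set Space) => Q x.1 := by
    ext x
    simp only [hQ', Function.comp_apply, homeomorphUnitSphereProd_apply_snd_coe,
      homeomorphUnitSphereProd_apply_fst_coe]
    rw [smul_smul, mul_inv_cancel₀ (norm_ne_zero_iff.2 x.2), one_smul]
  have hint : Integrable Q' ((volume : Measure Space).toSphere.prod (.volumeIoiPow 2)) := by
    rw [← hmp.integrable_comp_emb hemb, hcomp]
    exact (integrableOn_iff_comap_subtypeVal (measurableSet_singleton _).compl).1 hQ.integrableOn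
  calc ∫ s, Q s = ∫ x : ({(0)}ᶜ : Set Space), Q x.1 ∂((volume : Measure Space).comap (↑)) := by
        rw [integral_subtype_comap (measurableSet_singleton _).compl Q, restrict_compl_singleton]
    _ = ∫ z, Q' z ∂((volume : Measure Space).toSphere.prod (.volumeIoiPow 2)) := by
        rw [← hmp.integral_comp hemb]
        exact congrArg (fun F => integral _ F) hcomp.symm
    _ = _ := by
        rw [integral_prod _ hint]
        congr 1
        ext ω
        simp only [Measure.volumeIoiPow, ENNReal.ofReal, hQ']
        rw [integral_withDensity_eq_integral_smul
          ((measurable_subtype_coe.pow_const _).real_toNNReal),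
          integral_subtype_comap measurableSet_Ioi
            fun a => Real.toNNReal (a ^ 2) • Q (a • ω.1)]
        refine setIntegral_congr_fun measurableSet_Ioi fun x hx => ?_
        rw [NNReal.smul_def, Real.coe_toNNReal _ (pow_nonneg (le_of_lt hx) _), smul_eq_mul]

/-- The total mass is the dimension 3 times the unit ball's volume `4π / 3`. -/
lemma toSphere_real_univ : (volume : Measure Space).toSphere.real univ = 4 * Real.pi := by
  rw [Measure.toSphere_real_apply_univ, measureReal_def]
  simp
  ring_nf
  rw [ENNReal.toReal_ofReal (by positivity)]
  ring

/-! ### The static kernel -/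

/-- The gradient of `ζ(|s|) / |s|`. -/
noncomputable def staticGrad (i : Fin 3) (s : Space) : ℝ :=
  (radialCutoff₁ ‖s‖ / ‖s‖ - radialCutoff ‖s‖ / ‖s‖ ^ 2) * (s i / ‖s‖)

lemma staticGrad_of_one_le (i : Fin 3) (s : Space) (hs : 1 ≤ ‖s‖) : staticGrad i s = 0 := by
  simp [staticGrad, radialCutoff_of_one_le hs, radialCutoff₁_of_one_le hs]

lemma integrable_of_le_inv_sq {k : Space → ℝ} (hk : Measurable k)
    (hsupp : ∀ s, 1 ≤ ‖s‖ → k s = 0) {C : ℝ} (hle : ∀ s, ‖s‖ < 1 → |k s| ≤ C * (1 / ‖s‖ ^ 2)) :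
    Integrable k := by
  have h := ((integrable_indicator_iff measurableSet_ball).2 (integrableOn_inv_norm_sq 1)).const_mul C
  refine h.mono' hk.aestronglyMeasurable (Eventually.of_forall fun s => ?_)
  rcases le_or_gt 1 ‖s‖ with hs | hs
  · rw [hsupp s hs, indicator_of_notMem (by simpa using hs)]
    simp
  · rw [indicator_of_mem (by simpa using hs)]
    exact hle s hs

/-- The constant 4 is `3 + 1`, from `|ζ'| ≤ 3` and `|ζ| ≤ 1` on the unit ball. -/
lemma integrable_staticGrad (i : Fin 3) : Integrable (staticGrad i) := by
  refine integrable_of_le_inv_sq (C := 4) ?_ (staticGrad_of_one_le i) fun s hs => ?_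
  · have h0 : Measurable fun s : Space => radialCutoff ‖s‖ :=
      continuous_radialCutoff.measurable.comp (by fun_prop)
    have h1 : Measurable fun s : Space => radialCutoff₁ ‖s‖ :=
      continuous_radialCutoff₁.measurable.comp (by fun_prop)
    exact ((h1.div (by fun_prop)).sub (h0.div (by fun_prop))).mul (by fun_prop)
  · rcases eq_or_ne s 0 with rfl | hne
    · simp [staticGrad]
    have hpos : 0 < ‖s‖ := norm_pos_iff.2 hne
    rw [staticGrad, abs_mul]
    refine (mul_le_of_le_one_right (abs_nonneg _) (abs_coord_div_norm_le _ i)).trans ?_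
    have e : radialCutoff₁ ‖s‖ / ‖s‖ - radialCutoff ‖s‖ / ‖s‖ ^ 2 =
        (radialCutoff₁ ‖s‖ * ‖s‖ - radialCutoff ‖s‖) / ‖s‖ ^ 2 := by
      field_simp
    rw [e, abs_div, abs_of_nonneg (sq_nonneg ‖s‖), mul_one_div]
    gcongr
    refine (abs_sub _ _).trans ?_
    rw [abs_mul, abs_norm]
    nlinarith [abs_radialCutoff_le hpos.le, abs_radialCutoff₁_le hpos.le,
      abs_nonneg (radialCutoff₁ ‖s‖)]

/-- The second order remainder kernel `ζ''(|s|) / |s|`. -/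
noncomputable def remainderKernel (s : Space) : ℝ := radialCutoff₂ ‖s‖ / ‖s‖

lemma remainderKernel_of_one_le (s : Space) (hs : 1 ≤ ‖s‖) : remainderKernel s = 0 := by
  simp [remainderKernel, radialCutoff₂_of_one_le hs]

lemma integrable_remainderKernel : Integrable remainderKernel := by
  refine integrable_of_le_inv_sq (C := 6) ?_ remainderKernel_of_one_le fun s hs => ?_
  · exact (continuous_radialCutoff₂.measurable.comp (by fun_prop)).div (by fun_prop)
  · rcases eq_or_ne s 0 with rfl | hne
    · simp [remainderKernel]
    have hpos : 0 < ‖s‖ := norm_pos_iff.2 hne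
    rw [remainderKernel, abs_div, abs_norm, mul_one_div, div_le_div_iff₀ hpos (by positivity)]
    nlinarith [abs_radialCutoff₂_le hpos.le, mul_pos hpos hpos, abs_nonneg (radialCutoff₂ ‖s‖)]

/-- The Laplacian of the static potential. -/
lemma sum_integral_staticGrad {u : Space × ℝ → ℝ} {a : Fin 3 → Space × ℝ → ℝ}
    {b : Space × ℝ → ℝ} (hu : HasPartials u a b) (p : Space × ℝ) :
    ∑ i, ∫ s, staticGrad i s • a i (p.1 - s, p.2) =
      -(4 * Real.pi * u p) + ∫ s, remainderKernel s • u (p.1 - s, p.2) := by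
  have huc : Continuous u := hu.contDiff_one.continuous
  have i0 := fun i => integrable_convolution (τ := fun _ => 0) (integrable_staticGrad i)
    (staticGrad_of_one_le i) continuous_const (hu.continuous_space i) p
  have i1 := integrable_convolution (τ := fun _ => 0) integrable_remainderKernel
    remainderKernel_of_one_le continuous_const huc p
  simp only [sub_zero] at i0 i1
  rw [← integral_finsetSum _ fun i _ => i0 i, ← sub_eq_iff_eq_add,
    ← integral_sub (integrable_finsetSum _ fun i _ => i0 i) i1,
    integral_polar (Q := fun s => (∑ i, staticGrad i s • a i (p.1 - s, p.2)) -
      remainderKernel s • u (p.1 - s, p.2)) ((integrable_finsetSum _ fun i _ => i0 i).sub i1)]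
  have key : ∀ ω : sphere (0 : Space) 1, ∫ y in Ioi (0 : ℝ), y ^ 2 *
      ((∑ i, staticGrad i (y • ω.1) • a i (p.1 - y • ω.1, p.2)) -
        remainderKernel (y • ω.1) • u (p.1 - y • ω.1, p.2)) = -u p := by
    intro ω
    have hω : ‖ω.1‖ = 1 := by simp
    -- The Jacobian `y ^ 2` cancels every negative power of the radius, so the integrand along a ray
    -- extends continuously to `y = 0`.
    set D : ℝ → ℝ := fun y => (y * radialCutoff₁ y - radialCutoff y) *
      (∑ i, ω.1 i * a i (p.1 - y • ω.1, p.2)) - y * radialCutoff₂ y * u (p.1 - y • ω.1, p.2)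
      with hD
    have hc : Continuous D := by
      have := hu.continuous_space
      fun_prop
    have h1 : ∀ y : ℝ, 0 < y → y ^ 2 *
        ((∑ i, staticGrad i (y • ω.1) • a i (p.1 - y • ω.1, p.2)) -
        remainderKernel (y • ω.1) • u (p.1 - y • ω.1, p.2)) = D y := by
      intro y hy
      have hn : ‖y • ω.1‖ = y := by rw [norm_smul, hω, mul_one, Real.norm_of_nonneg hy.le]
      simp only [hD, staticGrad, remainderKernel, hn, smul_eq_mul, Fin.sum_univ_three,
        PiLp.smul_apply]
      field_simp
    rw [setIntegral_congr_fun measurableSet_Ioi fun y hy => h1 y hy]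
    have h2 : ∫ y in Ioi (0 : ℝ), D y = ∫ y in Ioc (0 : ℝ) 1, D y := by
      refine setIntegral_eq_of_subset_of_forall_sdiff_eq_zero measurableSet_Ioi Ioc_subset_Ioi_self
        fun y hy => ?_
      have hy1 : 1 ≤ y := by
        by_contra h
        exact hy.2 ⟨hy.1, by linarith⟩
      simp [hD, radialCutoff_of_one_le hy1, radialCutoff₁_of_one_le hy1,
        radialCutoff₂_of_one_le hy1]
    rw [h2, ← intervalIntegral.integral_of_le zero_le_one]
    -- The remainder kernel is chosen so that the radial integrand is an exact derivative. The
    -- primitive vanishes at `y = 1` and equals `u p` at `y = 0`, where `ζ(0) = 1`.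
    have hderiv : ∀ y : ℝ, HasDerivAt
        (fun y => -((y * radialCutoff₁ y - radialCutoff y) * u (p.1 - y • ω.1, p.2))) (D y) y := by
      intro y
      have hpath : HasDerivAt (fun y : ℝ => ((p.1 - y • ω.1, p.2) : Space × ℝ)) (-ω.1, 0) y := by
        have h := ((hasDerivAt_id y).smul_const ω.1).const_sub p.1
        rw [one_smul] at h
        exact h.prodMk (hasDerivAt_const y p.2)
      have hcomp := (hu.hasFDerivAt (p.1 - y • ω.1, p.2)).comp_hasDerivAt y hpath
      have hz := ((hasDerivAt_id y).mul (hasDerivAt_radialCutoff₁ y)).sub (hasDerivAt_radialCutoff y)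
      convert! (hz.mul hcomp).neg using 1
      simp only [hD, covector_apply, Fin.sum_univ_three, id, Function.comp_apply, PiLp.neg_apply]
      simp
      ring
    rw [intervalIntegral.integral_eq_sub_of_hasDerivAt (fun y _ => hderiv y)
      (hc.intervalIntegrable _ _)]
    simp [radialCutoff_zero, radialCutoff_of_one_le le_rfl, radialCutoff₁_of_one_le le_rfl]
  rw [integral_congr_ae (Eventually.of_forall key), integral_const, toSphere_real_univ, smul_eq_mul]
  ring

/-! ### Second partial derivatives -/

/-- `u` has continuous first and second partial derivatives. -/
structure HasSecondPartials (u : Space × ℝ → ℝ) (a : Fin 3 → Space × ℝ → ℝ) (b : Space × ℝ → ℝ)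
    (A : Fin 3 → Fin 3 → Space × ℝ → ℝ) (B : Fin 3 → Space × ℝ → ℝ) (b₂ : Space × ℝ → ℝ) :
    Prop where
  first : HasPartials u a b
  space : ∀ i, HasPartials (a i) (A i) (B i)
  time : HasPartials b B b₂
  symm : ∀ i j, A i j = A j i

section Partials

variable {u b b₂ : Space × ℝ → ℝ} {a B : Fin 3 → Space × ℝ → ℝ}
  {A : Fin 3 → Fin 3 → Space × ℝ → ℝ}

lemma covector_single (a : Fin 3 → ℝ) (b : ℝ) (i : Fin 3) :
    covector a b (EuclideanSpace.single i 1, 0) = a i := by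
  simp [covector_apply]

lemma covector_time (a : Fin 3 → ℝ) (b : ℝ) : covector a b (0, 1) = b := by
  simp [covector_apply]

/-- Symmetry of the second derivative, evaluated on coordinate directions, gives the symmetry of `A`
and identifies the time derivatives `B'` of the `a i` with the spatial derivatives `B` of `b`. -/
lemma HasSecondPartials.of_hasPartials {B' : Fin 3 → Space × ℝ → ℝ} (h : HasPartials u a b)
    (hs : ∀ i, HasPartials (a i) (A i) (B' i)) (ht : HasPartials b B b₂) :
    HasSecondPartials u a b A B b₂ := by
  have hL : ContDiff ℝ 1 fun p => covector (fun i => a i p) (b p) :=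
    contDiff_covector (fun i => (hs i).contDiff_one) ht.contDiff_one
  have hsymm := fun p v w => second_derivative_symmetric (𝕜 := ℝ) h.hasFDerivAt
    (hL.differentiable one_ne_zero p).hasFDerivAt v w
  have happ : ∀ p v w, fderiv ℝ (fun p => covector (fun i => a i p) (b p)) p v w =
      fderiv ℝ (fun p => covector (fun i => a i p) (b p) w) p v := by
    intro p v w
    rw [fderiv_clm_apply (hL.differentiable one_ne_zero p) (differentiableAt_const w)]
    simp
  have hi : ∀ p v i, fderiv ℝ (fun p => covector (fun i => a i p) (b p)) p v
      (EuclideanSpace.single i 1, 0) = covector (fun j => A i j p) (B' i p) v := by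
    intro p v i
    rw [happ]
    simp only [covector_single]
    rw [((hs i).hasFDerivAt p).fderiv]
  have h0 : ∀ p v, fderiv ℝ (fun p => covector (fun i => a i p) (b p)) p v (0, 1) =
      covector (fun j => B j p) (b₂ p) v := by
    intro p v
    rw [happ]
    simp only [covector_time]
    rw [(ht.hasFDerivAt p).fderiv]
  have hB : B' = B := by
    ext i p
    have := hsymm p (0, 1) (EuclideanSpace.single i 1, 0)
    rwa [hi, h0, covector_single, covector_time] at this
  subst hB
  refine ⟨h, hs, ht, fun i j => ?_⟩
  ext p
  have := hsymm p (EuclideanSpace.single j 1, 0) (EuclideanSpace.single i 1, 0)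
  rwa [hi, hi, covector_single, covector_single] at this

lemma HasSecondPartials.contDiff (h : HasSecondPartials u a b A B b₂) : ContDiff ℝ 2 u :=
  h.first.contDiff_succ (n := 1) (fun i => by simpa using (h.space i).contDiff_one)
    (by simpa using h.time.contDiff_one)

lemma HasPartials.hasFDerivAt_slice (h : HasPartials u a b) (x : Space) (t : ℝ) :
    HasFDerivAt (fun y => u (y, t)) ((covector (fun i => a i (x, t)) (b (x, t))).comp
      (ContinuousLinearMap.inl ℝ Space ℝ)) x :=
  (h.hasFDerivAt (x, t)).comp x (hasFDerivAt_prodMk_left x t)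

lemma HasPartials.partialDeriv_eq (h : HasPartials u a b) (i : Fin 3) (x : Space) (t : ℝ) :
    partialDeriv i (fun y => u (y, t)) x = a i (x, t) := by
  rw [partialDeriv, (h.hasFDerivAt_slice x t).fderiv]
  simp [covector_single]

lemma HasPartials.hasDerivAt_time (h : HasPartials u a b) (x : Space) (t : ℝ) :
    HasDerivAt (fun t => u (x, t)) (b (x, t)) t := by
  have := (h.hasFDerivAt (x, t)).comp_hasDerivAt t
    ((hasDerivAt_const t x).prodMk (hasDerivAt_id t))
  rwa [covector_time] at this

lemma HasSecondPartials.laplacian_eq (h : HasSecondPartials u a b A B b₂) (x : Space) (t : ℝ) :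
    (Δ (fun y => u (y, t))) x = ∑ i, A i i (x, t) := by
  rw [InnerProductSpace.laplacian_eq_iteratedFDeriv_orthonormalBasis _
    (EuclideanSpace.basisFun (Fin 3) ℝ)]
  refine Finset.sum_congr rfl fun i _ => ?_
  rw [iteratedFDeriv_two_apply]
  simp only [EuclideanSpace.basisFun_apply, Matrix.cons_val_zero, Matrix.cons_val_one]
  have e : fderiv ℝ (fun y => u (y, t)) = fun x => (covector (fun i => a i (x, t)) (b (x, t))).comp
      (ContinuousLinearMap.inl ℝ Space ℝ) := funext fun x => (h.first.hasFDerivAt_slice x t).fderiv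
  have hd : DifferentiableAt ℝ (fderiv ℝ (fun y => u (y, t))) x := by
    have h2 : ContDiff ℝ 2 (fun y => u (y, t)) := h.contDiff.comp (by fun_prop)
    exact ((h2.fderiv_right (m := 1) (by norm_num)).differentiable one_ne_zero) x
  have e2 : fderiv ℝ (fderiv ℝ fun y => u (y, t)) x (EuclideanSpace.single i 1)
      (EuclideanSpace.single i 1) = fderiv ℝ (fun z => fderiv ℝ (fun y => u (y, t)) z
        (EuclideanSpace.single i 1)) x (EuclideanSpace.single i 1) := by
    rw [fderiv_clm_apply hd (differentiableAt_const _)]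
    simp
  rw [e2, e]
  simp only [ContinuousLinearMap.comp_apply, ContinuousLinearMap.inl_apply, covector_single]
  exact (h.space i).partialDeriv_eq i x t

lemma HasSecondPartials.iteratedDeriv_eq (h : HasSecondPartials u a b A B b₂) (x : Space) (t : ℝ) :
    iteratedDeriv 2 (fun t => u (x, t)) t = b₂ (x, t) := by
  have e : deriv (fun t => u (x, t)) = fun t => b (x, t) :=
    funext fun t => (h.first.hasDerivAt_time x t).deriv
  rw [iteratedDeriv_succ, iteratedDeriv_one, e]
  exact (h.time.hasDerivAt_time x t).deriv

end Partials

/-! ### Potentials of admissible sources -/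

/-- A continuously differentiable source that is, for almost all points of space, twice
continuously differentiable in time with derivatives bounded by the weight `M`. -/
structure AdmissibleSource (M : Space → ℝ) (f : Space → ℝ → ℝ) : Prop where
  weight : KatoWeight M
  regular : IsRegular 1 f
  contDiff_time : ∀ᵐ r, ContDiff ℝ 2 (f r)
  bound : ∀ᵐ r, ∀ t, |f r t| ≤ M r
  bound₁ : ∀ᵐ r, ∀ t, |deriv (f r) t| ≤ M r
  bound₂ : ∀ᵐ r, ∀ t, |deriv (deriv (f r)) t| ≤ M r

/-- The delayed potential of a scalar source as a function on space-time. -/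
noncomputable def delayedPotential (c : ℝ) (f : Space → ℝ → ℝ) (p : Space × ℝ) : ℝ :=
  ∫ r, delayedKernel c f p r

section Potentials

variable {M : Space → ℝ} {c : ℝ} {f : Space → ℝ → ℝ}

lemma hasPartials_of_isRegular (hf : IsRegular 1 f) :
    HasPartials (fun p => f p.1 p.2)
      (fun i p => fderiv ℝ (fun p : Space × ℝ => f p.1 p.2) p (EuclideanSpace.single i 1, 0))
      (fun p => deriv (f p.1) p.2) := by
  have hf' : ContDiff ℝ 1 (fun p : Space × ℝ => f p.1 p.2) := by simpa [IsRegular] using hf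
  have hd : ∀ p, HasFDerivAt (fun p : Space × ℝ => f p.1 p.2)
      (fderiv ℝ (fun p : Space × ℝ => f p.1 p.2) p) p := fun p =>
    (hf'.differentiable one_ne_zero p).hasFDerivAt
  have hc := hf'.continuous_fderiv one_ne_zero
  have hb : ∀ p : Space × ℝ,
      deriv (f p.1) p.2 = fderiv ℝ (fun p : Space × ℝ => f p.1 p.2) p (0, 1) := fun p =>
    HasDerivAt.deriv (f := f p.1) ((hd p).comp_hasDerivAt (f := fun t => (p.1, t)) p.2
      ((hasDerivAt_const p.2 p.1).prodMk (hasDerivAt_id p.2)))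
  refine ⟨fun p => ?_, fun i => by fun_prop, ?_⟩
  · convert! hd p using 1
    refine ContinuousLinearMap.ext fun v => ?_
    have hv : v = ∑ i, v.1 i • ((EuclideanSpace.single i 1, 0) : Space × ℝ) + v.2 • (0, 1) := by
      refine Prod.ext ?_ ?_
      · ext j
        fin_cases j <;> simp [Fin.sum_univ_three]
      · simp [Fin.sum_univ_three]
    conv_rhs => rw [hv]
    rw [covector_apply, map_add, map_sum, hb]
    simp only [map_smul, smul_eq_mul]
    congr 1
    · exact Finset.sum_congr rfl fun i _ => mul_comm _ _
    · rw [mul_comm]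
  · simp only [hb]
    fun_prop

namespace AdmissibleSource

lemma continuous (hf : AdmissibleSource M f) : Continuous fun z : Space × ℝ => f z.1 z.2 :=
  (hasPartials_of_isRegular hf.regular).contDiff_one.continuous

lemma continuous_deriv (hf : AdmissibleSource M f) :
    Continuous fun z : Space × ℝ => deriv (f z.1) z.2 :=
  (hasPartials_of_isRegular hf.regular).continuous_time

lemma hasDerivAt (hf : AdmissibleSource M f) : ∀ᵐ r, ∀ t, HasDerivAt (f r) (deriv (f r) t) t := by
  filter_upwards [hf.contDiff_time] with r hr t
  exact (hr.differentiable two_ne_zero t).hasDerivAt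

lemma hasDerivAt₁ (hf : AdmissibleSource M f) :
    ∀ᵐ r, ∀ t, HasDerivAt (deriv (f r)) (deriv (deriv (f r)) t) t := by
  filter_upwards [hf.contDiff_time] with r hr t
  have h1 : ContDiff ℝ 1 (deriv (f r)) := ((contDiff_succ_iff_deriv (n := 1)).1 hr).2.2
  exact (h1.differentiable one_ne_zero t).hasDerivAt

lemma weightBounded (hf : AdmissibleSource M f) : WeightBounded M f where
  measurable := hf.continuous.measurable
  continuous_time := hf.contDiff_time.mono fun _ hr => hr.continuous
  bound := hf.bound

lemma weightBounded₁ (hf : AdmissibleSource M f) : WeightBounded M fun r => deriv (f r) where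
  measurable := hf.continuous_deriv.measurable
  continuous_time := hf.contDiff_time.mono fun _ hr => hr.continuous_deriv one_le_two
  bound := hf.bound₁

lemma weightBounded₂ (hf : AdmissibleSource M f) :
    WeightBounded M fun r => deriv (deriv (f r)) where
  measurable := measurable_deriv_with_param (f := fun r t => deriv (f r) t) hf.continuous_deriv
  continuous_time := hf.contDiff_time.mono fun _ hr =>
    ((contDiff_succ_iff_deriv (n := 1)).1 hr).2.2.continuous_deriv le_rfl
  bound := hf.bound₂

/-- The substitution `s = x - r` turns the static part into a convolution, whose next derivative can
fall on `f`. The form `p.2 - 0` matches the convolution lemmas with `τ = 0`. -/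
lemma delayedKernelDeriv_integral (hc : 0 < c) (hf : AdmissibleSource M f) (i : Fin 3)
    (p : Space × ℝ) :
    ∫ r, delayedKernelDeriv c f (fun r => deriv (f r)) i p r =
      (∫ r, regGrad c f (fun r => deriv (f r)) i p r) +
        ∫ s, staticGrad i s • f (p.1 - s) (p.2 - 0) := by
  have hint : Integrable fun s => staticGrad i s • f (p.1 - s) (p.2 - 0) :=
    integrable_convolution (τ := fun _ => 0) (integrable_staticGrad i)
      (staticGrad_of_one_le i) continuous_const hf.continuous p
  rw [← integral_sub_left_eq_self (fun s => staticGrad i s • f (p.1 - s) (p.2 - 0)) volume p.1,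
    ← integral_add ((hf.weightBounded.isKernel_regGrad hc hf.weightBounded₁ hf.hasDerivAt
      i).integrable hf.weight p) (hint.comp_sub_left p.1)]
  congr 1
  ext r
  rw [delayedKernelDeriv_eq, sub_sub_cancel, sub_zero, staticGrad, smul_eq_mul,
    mul_comm (f r p.2)]

/-- The delayed potential of an admissible source is twice continuously differentiable and
satisfies the wave equation. -/
theorem exists_hasSecondPartials (hc : 0 < c) (hf : AdmissibleSource M f) :
    ∃ A B, HasSecondPartials (delayedPotential c f)
      (fun i p => ∫ r, delayedKernelDeriv c f (fun r => deriv (f r)) i p r)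
      (delayedPotential c fun r => deriv (f r)) A B
      (delayedPotential c fun r => deriv (deriv (f r))) ∧
      ∀ p, ∑ i, A i i p - 1 / c ^ 2 * delayedPotential c (fun r => deriv (deriv (f r))) p =
        -(4 * Real.pi * f p.1 p.2) := by
  have hM := hf.weight
  have h0 := hf.weightBounded
  have h1 := hf.weightBounded₁
  have h2 := hf.weightBounded₂
  have hu := hasPartials_of_isRegular hf.regular
  have hfirst := hasPartials_delayed hc hM h0 h1 hf.continuous hf.hasDerivAt
  have htime := hasPartials_delayed hc hM h1 h2 hf.continuous_deriv hf.hasDerivAt₁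
  -- Here the splitting enters: the first derivatives of the potential cannot be differentiated
  -- under the integral directly, but each of the two summands can.
  have hspace : ∀ i, HasPartials
      (fun p => ∫ r, delayedKernelDeriv c f (fun r => deriv (f r)) i p r) _ _ := fun i => by
    simp only [hf.delayedKernelDeriv_integral hc i]
    exact (hasPartials_regGrad hc hM h0 h1 h2 hf.hasDerivAt hf.hasDerivAt₁ i).add
      (hu.convolution (integrable_staticGrad i) (staticGrad_of_one_le i) (τ := fun _ => 0)
        continuous_const)
  refine ⟨_, _, HasSecondPartials.of_hasPartials hfirst hspace htime, fun p => ?_⟩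
  have hlap := sum_integral_staticGrad hu p
  simp only [sub_zero, Finset.sum_add_distrib]
  rw [hlap, ← integral_finsetSum _ fun i _ => (h0.isKernel_regHess hc h1 h2 hf.hasDerivAt
    hf.hasDerivAt₁ i i).integrable hM p]
  have hrem : Integrable fun s => remainderKernel s • f (p.1 - s) p.2 := by
    have := integrable_convolution (τ := fun _ => 0) integrable_remainderKernel
      remainderKernel_of_one_le continuous_const hf.continuous p
    simpa using this
  have hpot := h2.isKernel (c := c) |>.integrable hM p
  -- The trace formula yields `∂²φ/∂t² / c²` minus the remainder integral, which cancels the one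
  -- produced by the static Laplacian.
  have e : ∫ r, ∑ i, regHess c f (fun r => deriv (f r)) (fun r => deriv (deriv (f r))) i i p r =
      1 / c ^ 2 * delayedPotential c (fun r => deriv (deriv (f r))) p -
        ∫ s, remainderKernel s • f (p.1 - s) p.2 := by
    rw [← integral_sub_left_eq_self (fun s => remainderKernel s • f (p.1 - s) p.2) volume p.1,
      delayedPotential, ← integral_const_mul,
      ← integral_sub (hpot.const_mul _) (hrem.comp_sub_left p.1)]
    refine integral_congr_ae ?_
    filter_upwards [ae_ne_point p.1] with r hne
    rw [sum_regHess hne, delayedKernel, sub_sub_cancel, remainderKernel, smul_eq_mul]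
    ring
  rw [e]
  ring

end AdmissibleSource

end Potentials

/-! ### Spatial cut-offs -/

section Cutoff

variable {M : Space → ℝ} {c : ℝ} {f : Space → ℝ → ℝ} {χ : Space → ℝ} {R : ℝ}

lemma integrable_indicator_inv_norm (R : ℝ) :
    Integrable ((ball (0 : Space) R).indicator fun s => ‖s‖⁻¹) := by
  rw [integrable_indicator_iff measurableSet_ball]
  refine (integrableOn_fun_norm_addHaar (E := Space) volume (f := fun y => y⁻¹)).2 ?_
  have : IntegrableOn (fun y : ℝ => y) (Ioo 0 R) :=
    (continuous_id.integrableOn_Icc).mono_set Ioo_subset_Icc_self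
  refine this.congr_fun (fun y hy => ?_) measurableSet_Ioo
  have := hy.1.ne'
  simp
  field_simp

lemma WeightBounded.cutoff (hf : WeightBounded M f) (hχ : Continuous χ) (hχ1 : ∀ r, |χ r| ≤ 1) :
    WeightBounded M fun r t => χ r * f r t where
  measurable := (hχ.measurable.comp measurable_fst).mul hf.measurable
  continuous_time := hf.continuous_time.mono fun _ hr => hr.const_mul _
  bound := hf.bound.mono fun r hr t => by
    rw [abs_mul]
    exact (mul_le_of_le_one_left (abs_nonneg _) (hχ1 r)).trans (hr t)

lemma HasPartials.cutoff {u : Space × ℝ → ℝ} {a : Fin 3 → Space × ℝ → ℝ} {b : Space × ℝ → ℝ}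
    (hu : HasPartials u a b) (hχ : ContDiff ℝ 1 χ) :
    HasPartials (fun p => χ p.1 * u p)
      (fun i p => partialDeriv i χ p.1 * u p + χ p.1 * a i p) (fun p => χ p.1 * b p) := by
  have huc : Continuous u := hu.contDiff_one.continuous
  have hχc := hχ.continuous
  have hχd := hχ.continuous_fderiv one_ne_zero
  have ha := hu.continuous_space
  have hb := hu.continuous_time
  refine ⟨fun p => ?_, fun i => ?_, by fun_prop⟩
  · have h1 : HasFDerivAt (fun p : Space × ℝ => χ p.1)
        (covector (fun i => partialDeriv i χ p.1) 0) p := by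
      have h := (hχ.differentiable one_ne_zero p.1).hasFDerivAt.comp p
        (hasFDerivAt_fst (𝕜 := ℝ) (E := Space) (F := ℝ))
      convert! h using 1
      refine ContinuousLinearMap.ext fun v => ?_
      have hv : v.1 = ∑ i, v.1 i • (EuclideanSpace.single i 1 : Space) := by
        ext j
        fin_cases j <;> simp [Fin.sum_univ_three]
      simp only [ContinuousLinearMap.comp_apply, ContinuousLinearMap.coe_fst']
      conv_rhs => rw [hv]
      rw [covector_apply, map_sum, zero_mul, add_zero]
      exact Finset.sum_congr rfl fun i _ => by rw [map_smul, smul_eq_mul, mul_comm]; rfl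
    refine HasFDerivAt.covector_congr (HasFDerivAt.covector_mul h1 (hu.hasFDerivAt p))
      (fun i => rfl) (by ring)
  · unfold partialDeriv
    fun_prop

/-- Differentiation of the delayed potential of a source that is cut off in space. -/
lemma AdmissibleSource.integral_cutoff (hc : 0 < c) (hf : AdmissibleSource M f)
    {a : Fin 3 → Space × ℝ → ℝ} {b : Space × ℝ → ℝ} (hu : HasPartials (fun p => f p.1 p.2) a b)
    (hχ : ContDiff ℝ 1 χ) (hχ1 : ∀ r, |χ r| ≤ 1) (hsupp : ∀ r, R ≤ ‖r‖ → χ r = 0) (i : Fin 3)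
    (p : Space × ℝ) :
    Integrable (delayedKernel c
        (fun r t => partialDeriv i χ r * f r t + χ r * a i (r, t)) p) ∧
      ∫ r, χ r * delayedKernelDeriv c f (fun r => deriv (f r)) i p r =
        ∫ r, delayedKernel c (fun r t => partialDeriv i χ r * f r t + χ r * a i (r, t)) p r := by
  -- If `q` is within 1 of `p` and `‖s‖ ≥ R'`, then `‖q.1 - s‖ > R`, so the source vanishes there
  -- and truncating `1 / ‖s‖` changes nothing.
  set R' := R + ‖p.1‖ + 2 with hR'
  set k : Space → ℝ := (ball (0 : Space) R').indicator fun s => ‖s‖⁻¹ with hk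
  have hki : Integrable k := integrable_indicator_inv_norm R'
  have hks : ∀ s, R' ≤ ‖s‖ → k s = 0 := fun s hs => indicator_of_notMem (by simpa using hs) _
  have hg := hu.cutoff hχ
  have hτ : Continuous fun s : Space => ‖s‖ / c := by fun_prop
  have hconv := hg.convolution hki hks hτ
  have hker : ∀ (h : Space → ℝ → ℝ), (∀ r t, R < ‖r‖ → h r t = 0) → ∀ q : Space × ℝ,
      q ∈ ball p 1 → (fun s => delayedKernel c h q (q.1 - s)) =
        fun s => k s • h (q.1 - s) (q.2 - ‖s‖ / c) := by
    intro h hh q hq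
    ext s
    rw [delayedKernel, sub_sub_cancel, smul_eq_mul, div_eq_inv_mul]
    rcases lt_or_ge ‖s‖ R' with hs | hs
    · rw [hk, indicator_of_mem (by simpa using hs)]
    · have h1 := mem_ball_fst hq
      rw [mem_ball, dist_eq_norm] at h1
      have h2 : ‖s‖ ≤ ‖q.1 - s‖ + ‖q.1 - p.1‖ + ‖p.1‖ := by
        have e : s = -(q.1 - s) + (q.1 - p.1) + p.1 := by abel
        calc ‖s‖ = ‖-(q.1 - s) + (q.1 - p.1) + p.1‖ := by rw [← e]
          _ ≤ _ := by
            refine (norm_add₃_le).trans ?_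
            rw [norm_neg]
      rw [hh _ _ (by linarith), mul_zero, mul_zero]
  have hpart : ∀ r, R < ‖r‖ → partialDeriv i χ r = 0 := by
    intro r hr
    have : χ =ᶠ[𝓝 r] fun _ => 0 := by
      filter_upwards [(isOpen_lt continuous_const continuous_norm).mem_nhds hr] with y hy
      exact hsupp y (le_of_lt hy)
    rw [partialDeriv, this.fderiv_eq]
    simp
  have hz : ∀ r t, R < ‖r‖ → partialDeriv i χ r * f r t + χ r * a i (r, t) = 0 := fun r t hr => by
    rw [hpart r hr, hsupp r hr.le]; ring
  have hz0 : ∀ r t, R < ‖r‖ → χ r * f r t = 0 := fun r t hr => by rw [hsupp r hr.le]; ring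
  have hpp := mem_ball_self (x := p) one_pos
  constructor
  · have h1 := integrable_convolution hki hks hτ (hg.continuous_space i) p
    have h3 : Integrable (fun s => delayedKernel c
        (fun r t => partialDeriv i χ r * f r t + χ r * a i (r, t)) p (p.1 - s)) := by
      rw [hker _ hz p hpp]
      exact h1
    have h4 := h3.comp_sub_left p.1
    simpa only [sub_sub_cancel] using h4
  · have hleft := (hasPartials_delayed hc hf.weight (hf.weightBounded.cutoff hχ.continuous hχ1)
      (hf.weightBounded₁.cutoff hχ.continuous hχ1)
      (f := fun r t => χ r * f r t) (f₁ := fun r t => χ r * deriv (f r) t)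
      ((hχ.continuous.comp continuous_fst).mul hf.continuous)
      (hf.hasDerivAt.mono fun r hr t => (hr t).const_mul (χ r))).hasFDerivAt p
    have heq : (fun q => ∫ r, delayedKernel c (fun r t => χ r * f r t) q r) =ᶠ[𝓝 p]
        fun q => ∫ s, k s • (χ (q.1 - s) * f (q.1 - s) (q.2 - ‖s‖ / c)) := by
      filter_upwards [ball_mem_nhds p one_pos] with q hq
      rw [← hker _ hz0 q hq]
      exact (integral_sub_left_eq_self _ volume q.1).symm
    -- The potential of `χ f` is differentiated in two ways: on the kernel with `r` fixed, and on
    -- the source with `s = x - r` fixed. Uniqueness of the derivative equates the results.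
    have huniq := hleft.unique ((hconv.hasFDerivAt p).congr_of_eventuallyEq heq)
    have happ := congrArg (fun L => L (EuclideanSpace.single i 1, 0)) huniq
    simp only [covector_single] at happ
    rw [← integral_sub_left_eq_self (fun r => delayedKernel c
      (fun r t => partialDeriv i χ r * f r t + χ r * a i (r, t)) p r) volume p.1,
      hker _ hz p hpp, ← happ]
    congr 1
    ext r
    unfold delayedKernelDeriv
    ring

end Cutoff

/-! ### The Lorenz gauge condition -/

/-- Rescaling a fixed bump by `n + 1` divides its gradient by `n + 1`. -/
lemma exists_cutoff_sequence : ∃ (χ : ℕ → Space → ℝ) (C : ℝ), 0 ≤ C ∧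
    (∀ n, ContDiff ℝ 1 (χ n)) ∧ (∀ n r, |χ n r| ≤ 1) ∧
    (∀ n : ℕ, ∀ r, 2 * ((n : ℝ) + 1) ≤ ‖r‖ → χ n r = 0) ∧
    (∀ r, ∀ᶠ n in atTop, χ n r = 1) ∧
    ∀ n i r, |partialDeriv i (χ n) r| ≤ C / ((n : ℝ) + 1) := by
  let χ₀ : ContDiffBump (0 : Space) := ⟨1, 2, one_pos, one_lt_two⟩
  have hχ₀ : ContDiff ℝ 1 (χ₀ : Space → ℝ) := χ₀.contDiff
  obtain ⟨C, hC⟩ := (χ₀.hasCompactSupport.fderiv (𝕜 := ℝ)).exists_bound_of_continuous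
    (hχ₀.continuous_fderiv one_ne_zero)
  refine ⟨fun n r => χ₀ (((n : ℝ) + 1)⁻¹ • r), C, (norm_nonneg _).trans (hC 0),
    fun n => hχ₀.comp (by fun_prop), fun n r => ?_, fun n r hr => ?_, fun r => ?_, fun n i r => ?_⟩
  · rw [abs_of_nonneg χ₀.nonneg]
    exact χ₀.le_one
  · refine χ₀.zero_of_le_dist ?_
    rw [dist_zero_right, norm_smul, norm_inv, Real.norm_of_nonneg (by positivity),
      ← div_eq_inv_mul, le_div_iff₀ (by positivity)]
    exact hr
  · obtain ⟨N, hN⟩ := exists_nat_ge ‖r‖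
    filter_upwards [eventually_ge_atTop N] with n hn
    refine χ₀.one_of_mem_closedBall ?_
    rw [mem_closedBall, dist_zero_right, norm_smul, norm_inv,
      Real.norm_of_nonneg (by positivity), ← div_eq_inv_mul]
    refine div_le_one_of_le₀ ?_ (by positivity)
    have : (N : ℝ) ≤ n := by exact_mod_cast hn
    linarith
  · have hd : HasFDerivAt (fun r => χ₀ (((n : ℝ) + 1)⁻¹ • r))
        ((fderiv ℝ χ₀ (((n : ℝ) + 1)⁻¹ • r)).comp
          (((n : ℝ) + 1)⁻¹ • ContinuousLinearMap.id ℝ Space)) r :=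
      HasFDerivAt.comp (g := (χ₀ : Space → ℝ)) (f := fun r => ((n : ℝ) + 1)⁻¹ • r) r (hχ₀.differentiable one_ne_zero _).hasFDerivAt
        (((n : ℝ) + 1)⁻¹ • ContinuousLinearMap.id ℝ Space).hasFDerivAt
    rw [partialDeriv, hd.fderiv]
    simp only [ContinuousLinearMap.comp_apply, smul_apply, ContinuousLinearMap.id_apply, map_smul,
      smul_eq_mul]
    rw [abs_mul, abs_of_nonneg (by positivity), ← div_eq_inv_mul]
    gcongr
    have h1 := (fderiv ℝ χ₀ (((n : ℝ) + 1)⁻¹ • r)).le_opNorm (EuclideanSpace.single i 1)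
    rw [PiLp.norm_single, norm_one, mul_one] at h1
    exact h1.trans (hC _)

/-- The Lorenz gauge condition for the integrals that represent the derivatives of the delayed
potentials. -/
theorem lorenz_gauge_integral {M : Space → ℝ} {N : Fin 3 → Space → ℝ} {c : ℝ} (hc : 0 < c)
    {ρ : Space → ℝ → ℝ} {j : Fin 3 → Space → ℝ → ℝ} (hρ : AdmissibleSource M ρ)
    (hj : ∀ k, AdmissibleSource (N k) (j k))
    (hcont : ∀ x t, ∑ k, partialDeriv k (fun y => j k y t) x + deriv (ρ x) t = 0)
    (p : Space × ℝ) :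
    (∑ k, ∫ r, delayedKernelDeriv c (j k) (fun r => deriv (j k r)) k p r) +
      delayedPotential c (fun r => deriv (ρ r)) p = 0 := by
  obtain ⟨χ, C, hC, hχ, hχ1, hsupp, hlim, hχd⟩ := exists_cutoff_sequence
  have hu := fun k => hasPartials_of_isRegular (hj k).regular
  have hDint := fun k => ((hj k).weightBounded.isKernel_deriv hc (hj k).weight
    (hj k).weightBounded₁ (hj k).continuous k).integrable (hj k).weight p
  have hjint := fun k => ((hj k).weightBounded.isKernel (c := c)).integrable (hj k).weight p
  have hρint := (hρ.weightBounded₁.isKernel (c := c)).integrable hρ.weight p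
  have hcut := fun n k => (hj k).integral_cutoff hc (hu k) (hχ n) (hχ1 n) (hsupp n) k p
  have hpd : ∀ k x t, partialDeriv k (fun y => j k y t) x =
      fderiv ℝ (fun p : Space × ℝ => j k p.1 p.2) (x, t) (EuclideanSpace.single k 1, 0) :=
    fun k x t => (hu k).partialDeriv_eq k x t
  -- The derivative is moved onto `χₙ j`; the continuity equation at the retarded time replaces the
  -- divergence of `j` by `-∂ρ/∂t`, leaving only the term with the gradient of `χₙ`.
  have hid : ∀ n, ∑ k, ∫ r, χ n r * delayedKernelDeriv c (j k) (fun r => deriv (j k r)) k p r =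
      ∫ r, (∑ k, partialDeriv k (χ n) r * delayedKernel c (j k) p r -
        χ n r * delayedKernel c (fun r => deriv (ρ r)) p r) := by
    intro n
    rw [Finset.sum_congr rfl fun k _ => (hcut n k).2,
      ← integral_finsetSum _ fun k _ => (hcut n k).1]
    congr 1
    ext r
    have h := hcont r (p.2 - ‖p.1 - r‖ / c)
    simp only [hpd] at h
    simp only [delayedKernel, Fin.sum_univ_three] at h ⊢
    rw [eq_neg_of_add_eq_zero_right h]
    ring
  have hl : Tendsto (fun n => ∑ k, ∫ r, χ n r *
      delayedKernelDeriv c (j k) (fun r => deriv (j k r)) k p r) atTop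
      (𝓝 (∑ k, ∫ r, delayedKernelDeriv c (j k) (fun r => deriv (j k r)) k p r)) := by
    refine tendsto_finsetSum _ fun k _ => tendsto_integral_of_dominated_convergence
      (fun r => |delayedKernelDeriv c (j k) (fun r => deriv (j k r)) k p r|)
      (fun n => (hχ n).continuous.aestronglyMeasurable.mul (hDint k).1) (hDint k).abs
      (fun n => Eventually.of_forall fun r => ?_) (Eventually.of_forall fun r => ?_)
    · rw [Real.norm_eq_abs, abs_mul]
      exact mul_le_of_le_one_left (abs_nonneg _) (hχ1 n r)
    · refine tendsto_const_nhds.congr' ?_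
      filter_upwards [hlim r] with n hn
      rw [hn, one_mul]
  -- The kernels of `j` and `∂ρ/∂t` are absolutely integrable, so dominated convergence applies; the
  -- cut-off gradients tend to 0 and the cut-offs to 1.
  have hr : Tendsto (fun n => ∫ r, (∑ k, partialDeriv k (χ n) r * delayedKernel c (j k) p r -
        χ n r * delayedKernel c (fun r => deriv (ρ r)) p r)) atTop
      (𝓝 (∫ r, (∑ k : Fin 3, 0 * delayedKernel c (j k) p r -
        1 * delayedKernel c (fun r => deriv (ρ r)) p r))) := by
    have hmeas : ∀ n k, Continuous fun r => partialDeriv k (χ n) r := fun n k => by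
      have := (hχ n).continuous_fderiv one_ne_zero
      unfold partialDeriv
      fun_prop
    refine tendsto_integral_of_dominated_convergence
      (fun r => ∑ k, C * |delayedKernel c (j k) p r| +
        |delayedKernel c (fun r => deriv (ρ r)) p r|) (fun n => ?_) ?_
      (fun n => Eventually.of_forall fun r => ?_) (Eventually.of_forall fun r => ?_)
    · refine AEStronglyMeasurable.sub ?_ ((hχ n).continuous.aestronglyMeasurable.mul hρint.1)
      exact Finset.aestronglyMeasurable_fun_sum _ fun k _ =>
        (hmeas n k).aestronglyMeasurable.mul (hjint k).1
    · exact (integrable_finsetSum _ fun k _ => (hjint k).abs.const_mul C).add hρint.abs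
    · refine (norm_sub_le _ _).trans (add_le_add ((norm_sum_le _ _).trans
        (Finset.sum_le_sum fun k _ => ?_)) ?_)
      · rw [Real.norm_eq_abs, abs_mul]
        refine mul_le_mul_of_nonneg_right ((hχd n k r).trans ?_) (abs_nonneg _)
        exact div_le_self hC (by linarith [(n.cast_nonneg : (0 : ℝ) ≤ n)])
      · rw [Real.norm_eq_abs, abs_mul]
        exact mul_le_of_le_one_left (abs_nonneg _) (hχ1 n r)
    · refine Tendsto.sub (tendsto_finsetSum _ fun k _ => Tendsto.mul_const _ ?_)
        (Tendsto.mul_const _ ?_)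
      · refine squeeze_zero_norm (fun n => hχd n k r) ?_
        exact tendsto_const_nhds.div_atTop
          (tendsto_atTop_add_const_right _ _ tendsto_natCast_atTop_atTop)
      · refine tendsto_const_nhds.congr' ?_
        filter_upwards [hlim r] with n hn
        exact hn.symm
  simp only [hid] at hl
  have := tendsto_nhds_unique hl hr
  rw [this]
  simp only [zero_mul, Finset.sum_const_zero, one_mul, zero_sub, integral_neg]
  rw [delayedPotential]
  ring

/-! ### Vector fields with continuous partial derivatives -/

section VectorField

variable {F : Space → ℝ → Space} {a : Fin 3 → Fin 3 → Space × ℝ → ℝ} {b : Fin 3 → Space × ℝ → ℝ}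

lemma isRegular_of_hasPartials (hF : ∀ k, HasPartials (fun p => F p.1 p.2 k) (a k) (b k)) :
    IsRegular 1 F := by
  have : ContDiff ℝ 1 (fun p : Space × ℝ => F p.1 p.2) :=
    contDiff_euclidean.2 fun k => (hF k).contDiff_one
  simpa [IsRegular] using this

lemma div_eq_of_hasPartials (hF : ∀ k, HasPartials (fun p => F p.1 p.2 k) (a k) (b k))
    (x : Space) (t : ℝ) : div (fun y => F y t) x = ∑ k, a k k (x, t) :=
  Finset.sum_congr rfl fun k _ => (hF k).partialDeriv_eq k x t

lemma rot_eq_of_hasPartials (hF : ∀ k, HasPartials (fun p => F p.1 p.2 k) (a k) (b k))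
    (x : Space) (t : ℝ) : rot (fun y => F y t) x =
      !₂[a 2 1 (x, t) - a 1 2 (x, t), a 0 2 (x, t) - a 2 0 (x, t), a 1 0 (x, t) - a 0 1 (x, t)] := by
  have h := fun k i => (hF k).partialDeriv_eq i x t
  simp only at h
  simp only [rot, h]

lemma deriv_time_eq_of_hasPartials (hF : ∀ k, HasPartials (fun p => F p.1 p.2 k) (a k) (b k))
    (x : Space) (t : ℝ) : deriv (F x) t = !₂[b 0 (x, t), b 1 (x, t), b 2 (x, t)] := by
  have h : HasDerivAt (F x) (!₂[b 0 (x, t), b 1 (x, t), b 2 (x, t)]) t := by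
    rw [hasDerivAt_iff_hasFDerivAt, ← hasFDerivWithinAt_univ, hasFDerivWithinAt_euclidean]
    intro k
    have := ((hF k).hasDerivAt_time x t).hasFDerivAt
    convert! this.hasFDerivWithinAt using 1
    ext
    fin_cases k <;> simp
  exact h.deriv

lemma gradient_apply (g : Space → ℝ) (x : Space) (i : Fin 3) : (∇ g x) i = partialDeriv i g x := by
  rw [partialDeriv, ← inner_gradient_left, EuclideanSpace.inner_single_right]
  simp

end VectorField

lemma HasPartials.const_mul {u b : Space × ℝ → ℝ} {a : Fin 3 → Space × ℝ → ℝ}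
    (h : HasPartials u a b) (k : ℝ) :
    HasPartials (fun p => k * u p) (fun i p => k * a i p) (fun p => k * b p) where
  hasFDerivAt p := HasFDerivAt.covector_const_mul (h.hasFDerivAt p) k
  continuous_space i := continuous_const.mul (h.continuous_space i)
  continuous_time := continuous_const.mul h.continuous_time

lemma HasSecondPartials.const_mul {u b b₂ : Space × ℝ → ℝ} {a B : Fin 3 → Space × ℝ → ℝ}
    {A : Fin 3 → Fin 3 → Space × ℝ → ℝ} (h : HasSecondPartials u a b A B b₂) (k : ℝ) :
    HasSecondPartials (fun p => k * u p) (fun i p => k * a i p) (fun p => k * b p)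
      (fun i j p => k * A i j p) (fun i p => k * B i p) (fun p => k * b₂ p) where
  first := h.first.const_mul k
  space i := (h.space i).const_mul k
  time := h.time.const_mul k
  symm i j := by rw [h.symm]

/-! ### Maxwell's equations for potentials in the Lorenz gauge -/

section Maxwell

variable {c : ℝ} {ρ : Space → ℝ → ℝ} {j : Space → ℝ → Space} {φ : Space → ℝ → ℝ}
  {A : Space → ℝ → Space}
  {φ₁ : Fin 3 → Space × ℝ → ℝ} {φt φtt : Space × ℝ → ℝ} {φ₂ : Fin 3 → Fin 3 → Space × ℝ → ℝ}
  {φ₁t : Fin 3 → Space × ℝ → ℝ} {a : Fin 3 → Fin 3 → Space × ℝ → ℝ} {at' : Fin 3 → Space × ℝ → ℝ}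
  {a₂ : Fin 3 → Fin 3 → Fin 3 → Space × ℝ → ℝ} {a₁t : Fin 3 → Fin 3 → Space × ℝ → ℝ}
  {att : Fin 3 → Space × ℝ → ℝ}

/-- Potentials with continuous second partial derivatives that satisfy the Lorenz gauge condition
and the wave equations form a potential solution. -/
lemma isPotentialSolution_of_hasSecondPartials
    (hφ : HasSecondPartials (fun p => φ p.1 p.2) φ₁ φt φ₂ φ₁t φtt)
    (hA : ∀ k, HasSecondPartials (fun p => A p.1 p.2 k) (a k) (at' k) (a₂ k) (a₁t k) (att k))
    (hgauge : ∀ p, ∑ k, a k k p + 1 / c * φt p = 0)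
    (hwφ : ∀ p, ∑ i, φ₂ i i p - 1 / c ^ 2 * φtt p = -(4 * Real.pi * ρ p.1 p.2))
    (hwA : ∀ k p, ∑ i, a₂ k i i p - 1 / c ^ 2 * att k p = -(4 * Real.pi / c * j p.1 p.2 k)) :
    IsPotentialSolution c ρ j φ A := by
  have hAc : ContDiff ℝ 2 fun p : Space × ℝ => A p.1 p.2 :=
    contDiff_euclidean.2 fun k => (hA k).contDiff
  refine ⟨by simpa [IsRegular] using hφ.contDiff, by simpa [IsRegular] using hAc,
    fun x t => ?_, fun x t => ?_, fun x t => ?_⟩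
  · have h1 : deriv (φ x) t = φt (x, t) := (hφ.first.hasDerivAt_time x t).deriv
    rw [div_eq_of_hasPartials fun k => (hA k).first, h1]
    exact hgauge (x, t)
  · ext k
    -- Laplacian and iterated time derivative commute with the coordinate projections, so the vector
    -- equation reduces to its components.
    have h1 : ((Δ (fun y => A y t)) x) k = (Δ (fun y => A y t k)) x := by
      have hs : ContDiffAt ℝ 2 (fun y => A y t) x := by
        have : ContDiff ℝ 2 fun y => A y t := hAc.comp (f := fun y => (y, t)) (by fun_prop)
        exact this.contDiffAt
      exact (hs.laplacian_CLM_comp_left (l := (EuclideanSpace.proj k : Space →L[ℝ] ℝ))).symm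
    have h2 : (iteratedDeriv 2 (A x) t) k = iteratedDeriv 2 (fun t => A x t k) t := by
      have hs : ContDiff ℝ 2 (A x) := hAc.comp (f := fun t => (x, t)) (by fun_prop)
      have e := (EuclideanSpace.proj k : Space →L[ℝ] ℝ).iteratedFDeriv_comp_left
        (hs.contDiffAt (x := t)) (i := 2) le_rfl
      have e' := congrArg (fun m => m fun _ => (1 : ℝ)) e
      exact e'.symm
    have h3 := (hA k).laplacian_eq x t
    have h4 := (hA k).iteratedDeriv_eq x t
    simp only at h3 h4
    have h5 := hwA k (x, t)
    simp only [PiLp.sub_apply, PiLp.smul_apply, PiLp.neg_apply, smul_eq_mul, h1, h2, h3, h4]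
    exact h5
  · have h3 := hφ.laplacian_eq x t
    have h4 := hφ.iteratedDeriv_eq x t
    simp only at h3 h4
    have h4' : iteratedDeriv 2 (φ x) t = φtt (x, t) := h4
    rw [h3, h4']
    exact hwφ (x, t)

lemma isMaxwellSolution_of_hasSecondPartials
    (hφ : HasSecondPartials (fun p => φ p.1 p.2) φ₁ φt φ₂ φ₁t φtt)
    (hA : ∀ k, HasSecondPartials (fun p => A p.1 p.2 k) (a k) (at' k) (a₂ k) (a₁t k) (att k))
    (hgauge : ∀ p, ∑ k, a k k p + 1 / c * φt p = 0)
    (hwφ : ∀ p, ∑ i, φ₂ i i p - 1 / c ^ 2 * φtt p = -(4 * Real.pi * ρ p.1 p.2))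
    (hwA : ∀ k p, ∑ i, a₂ k i i p - 1 / c ^ 2 * att k p = -(4 * Real.pi / c * j p.1 p.2 k)) :
    IsMaxwellSolution c ρ j (electricField c φ A) (magneticField A) := by
  have hE : ∀ k, HasPartials (fun p => electricField c φ A p.1 p.2 k)
      (fun i p => -1 * φ₂ k i p + -(1 / c) * a₁t k i p)
      (fun p => -1 * φ₁t k p + -(1 / c) * att k p) := by
    intro k
    convert! ((hφ.space k).const_mul (-1)).add ((hA k).time.const_mul (-(1 / c))) using 1
    ext p
    have h1 := hφ.first.partialDeriv_eq k p.1 p.2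
    have h2 : (deriv (A p.1) p.2) k = at' k p := by
      rw [deriv_time_eq_of_hasPartials fun k => (hA k).first]
      fin_cases k <;> rfl
    simp only at h1
    simp only [electricField, PiLp.sub_apply, PiLp.neg_apply, PiLp.smul_apply, smul_eq_mul,
      gradient_apply, h1, h2]
    ring
  have hcurl : ∀ l m r s, HasPartials (fun p => a l m p + -1 * a r s p)
      (fun i p => a₂ l m i p + -1 * a₂ r s i p) (fun p => a₁t l m p + -1 * a₁t r s p) :=
    fun l m r s => ((hA l).space m).add (((hA r).space s).const_mul (-1))
  have hHeq : ∀ p : Space × ℝ, magneticField A p.1 p.2 =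
      !₂[a 2 1 p - a 1 2 p, a 0 2 p - a 2 0 p, a 1 0 p - a 0 1 p] := fun p =>
    rot_eq_of_hasPartials (fun k => (hA k).first) p.1 p.2
  -- Indices in `Fin 3` are cyclic: `H_k = ∂_{k+1} A_{k+2} - ∂_{k+2} A_{k+1}`, where `a l m` stands
  -- for `∂_m A_l`.
  have hH : ∀ k, HasPartials (fun p => magneticField A p.1 p.2 k)
      (fun i p => a₂ (k + 2) (k + 1) i p + -1 * a₂ (k + 1) (k + 2) i p)
      (fun p => a₁t (k + 2) (k + 1) p + -1 * a₁t (k + 1) (k + 2) p) := by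
    intro k
    convert! hcurl (k + 2) (k + 1) (k + 1) (k + 2) using 1
    ext p
    rw [hHeq]
    fin_cases k <;> simp <;> ring_nf
  -- The gauge expression vanishes identically, hence so do its space and time derivatives; these
  -- enter Ampère's law and the electric Gauss law respectively.
  have hg := (((hA 0).space 0).add (((hA 1).space 1).add ((hA 2).space 2))).add
    (hφ.time.const_mul (1 / c))
  have hg0 : ∀ p, HasFDerivAt (fun p => a 0 0 p + (a 1 1 p + a 2 2 p) + 1 / c * φt p)
      (0 : Space × ℝ →L[ℝ] ℝ) p := by
    intro p
    have e : (fun p => a 0 0 p + (a 1 1 p + a 2 2 p) + 1 / c * φt p) = fun _ => (0 : ℝ) := by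
      ext p
      rw [← hgauge p, Fin.sum_univ_three]
      ring
    rw [e]
    exact hasFDerivAt_const _ _
  have hgs : ∀ i p, a₂ 0 0 i p + (a₂ 1 1 i p + a₂ 2 2 i p) + 1 / c * φ₁t i p = 0 := by
    intro i p
    have := congrArg (fun L => L (EuclideanSpace.single i 1, 0))
      ((hg.hasFDerivAt p).unique (hg0 p))
    simpa only [covector_single, zero_apply] using this
  have hgt : ∀ p, a₁t 0 0 p + (a₁t 1 1 p + a₁t 2 2 p) + 1 / c * φtt p = 0 := by
    intro p
    have := congrArg (fun L => L (0, 1)) ((hg.hasFDerivAt p).unique (hg0 p))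
    simpa only [covector_time, zero_apply] using this
  refine ⟨isRegular_of_hasPartials hE, isRegular_of_hasPartials hH, fun x t => ?_, fun x t => ?_,
    fun x t => ?_, fun x t => ?_⟩
  · rw [rot_eq_of_hasPartials hE, deriv_time_eq_of_hasPartials hH]
    have s01 := congrFun (hφ.symm 0 1) (x, t)
    have s02 := congrFun (hφ.symm 0 2) (x, t)
    have s12 := congrFun (hφ.symm 1 2) (x, t)
    ext k
    fin_cases k <;> simp [s01, s02, s12] <;> ring_nf
  -- This is `rot rot A = grad div A - ΔA` in components: the gradient of the gauge identity cancels
  -- the term in `∂ grad φ/∂t`, and the wave equation supplies the current.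
  · rw [rot_eq_of_hasPartials hH, deriv_time_eq_of_hasPartials hE]
    have s := fun k l m => congrFun ((hA k).symm l m) (x, t)
    have w := fun k => hwA k (x, t)
    have g := fun i => hgs i (x, t)
    simp only [Fin.sum_univ_three] at w
    ext k
    fin_cases k
    · simp
      linear_combination g 0 - w 0 + s 1 0 1 + s 2 0 2
    · simp
      linear_combination g 1 - w 1 + s 2 1 2 + s 0 1 0
    · simp
      linear_combination g 2 - w 2 + s 0 2 0 + s 1 2 1
  · rw [div_eq_of_hasPartials hH, Fin.sum_univ_three]
    have s := fun k l m => congrFun ((hA k).symm l m) (x, t)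
    simp
    linear_combination s 2 1 0 + s 0 2 1 + s 1 0 2
  · rw [div_eq_of_hasPartials hE]
    have w := hwφ (x, t)
    have g := hgt (x, t)
    simp only [Fin.sum_univ_three] at w ⊢
    linear_combination -w - 1/c * g

end Maxwell

/-! ### Delayed potentials of admissible sources -/

/-- The delayed potentials of admissible sources that satisfy the continuity equation. -/
theorem delayedPotentialsSolve_of_admissible {c : ℝ} (hc : 0 < c) {M : Space → ℝ}
    {N : Fin 3 → Space → ℝ} {ρ : Space → ℝ → ℝ} {j : Space → ℝ → Space}
    (hρ : AdmissibleSource M ρ) (hj : ∀ k, AdmissibleSource (N k) fun r t => j r t k)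
    (hcont : ContinuityEquation ρ j) : DelayedPotentialsSolve c ρ j := by
  have hint : ∀ {M : Space → ℝ} {f : Space → ℝ → ℝ}, AdmissibleSource M f → ∀ x t,
      Integrable (delayedIntegrand c f x t) := by
    intro M f hf x t
    have h := (hf.weightBounded.isKernel (c := c)).integrable hf.weight (x, t)
    refine h.congr (Eventually.of_forall fun r => ?_)
    simp only [delayedKernel, delayedIntegrand, smul_eq_mul, div_eq_inv_mul]
  have hpot : ∀ (f : Space → ℝ → ℝ) (x : Space) (t : ℝ),
      ∫ r, delayedIntegrand c f x t r = delayedPotential c f (x, t) := by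
    intro f x t
    simp only [delayedPotential, delayedKernel, delayedIntegrand, smul_eq_mul, div_eq_inv_mul]
  have hintj : ∀ x t, Integrable (delayedIntegrand c j x t) := fun x t =>
    Integrable.of_eval_piLp fun k => hint (hj k) x t
  have hφe : (fun p : Space × ℝ => scalarPotential c ρ p.1 p.2) = delayedPotential c ρ :=
    funext fun p => hpot ρ p.1 p.2
  have hAe : ∀ k, (fun p : Space × ℝ => vectorPotential c j p.1 p.2 k) =
      fun p => 1 / c * delayedPotential c (fun r t => j r t k) p := by
    intro k
    ext p
    rw [vectorPotential, PiLp.smul_apply, smul_eq_mul,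
      eval_integral_piLp fun k => hint (hj k) p.1 p.2]
    congr 1
    exact hpot (fun r t => j r t k) p.1 p.2
  obtain ⟨φ₂, φ₁t, hφ, hwφ⟩ := hρ.exists_hasSecondPartials hc
  choose a₂ a₁t hA hwA using fun k => (hj k).exists_hasSecondPartials hc
  rw [← hφe] at hφ
  have hA' := fun k => (hA k).const_mul (1 / c)
  simp only [← hAe] at hA'
  have hgauge : ∀ p, (∑ k, 1 / c * ∫ r, delayedKernelDeriv c (fun r t => j r t k)
      (fun r => deriv fun t => j r t k) k p r) +
      1 / c * delayedPotential c (fun r => deriv (ρ r)) p = 0 := by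
    intro p
    rw [← Finset.mul_sum, ← mul_add, lorenz_gauge_integral hc hρ hj (fun x t => hcont x t) p,
      mul_zero]
  have hwA' : ∀ k p, ∑ i, 1 / c * a₂ k i i p - 1 / c ^ 2 * (1 / c *
      delayedPotential c (fun r => deriv (deriv fun t => j r t k)) p) =
        -(4 * Real.pi / c * j p.1 p.2 k) := by
    intro k p
    have := hwA k p
    rw [← Finset.mul_sum]
    linear_combination 1 / c * this
  exact ⟨hint hρ, hintj,
    isPotentialSolution_of_hasSecondPartials hφ hA' hgauge hwφ hwA',
    isMaxwellSolution_of_hasSecondPartials hφ hA' hgauge hwφ hwA'⟩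

/-! ### Temporal Fourier transforms -/

/-- The Fourier integral `∫ g(ω) exp(-iωt) dω`. -/
noncomputable def fourierIntegralTime (g : ℝ → ℂ) (t : ℝ) : ℂ :=
  ∫ ω : ℝ, g ω * Complex.exp (-(Complex.I * ω * t))

lemma norm_exp_phase (ω t : ℝ) : ‖Complex.exp (-(Complex.I * ω * t))‖ = 1 := by
  rw [Complex.norm_exp]
  simp

lemma integrable_mul_phase {g : ℝ → ℂ} (hg : Integrable g) (t : ℝ) :
    Integrable fun ω : ℝ => g ω * Complex.exp (-(Complex.I * ω * t)) := by
  refine hg.mono (hg.1.mul (Continuous.aestronglyMeasurable (by fun_prop)))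
    (Eventually.of_forall fun ω => ?_)
  rw [norm_mul, norm_exp_phase, mul_one]

lemma norm_fourierIntegralTime_le (g : ℝ → ℂ) (t : ℝ) :
    ‖fourierIntegralTime g t‖ ≤ ∫ ω, ‖g ω‖ := by
  refine (norm_integral_le_integral_norm _).trans (le_of_eq ?_)
  congr 1
  ext ω
  rw [norm_mul, norm_exp_phase, mul_one]

lemma continuous_fourierIntegralTime {g : ℝ → ℂ} (hg : Integrable g) :
    Continuous (fourierIntegralTime g) := by
  refine continuous_of_dominated (bound := fun ω => ‖g ω‖)
    (fun t => (integrable_mul_phase hg t).1) (fun t => Eventually.of_forall fun ω => ?_) hg.norm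
    (Eventually.of_forall fun ω => by fun_prop)
  rw [norm_mul, norm_exp_phase, mul_one]

lemma hasDerivAt_fourierIntegralTime {g : ℝ → ℂ} (hg : Integrable g)
    (hg₁ : Integrable fun ω : ℝ => -(Complex.I * ω) * g ω) (t : ℝ) :
    HasDerivAt (fourierIntegralTime g)
      (fourierIntegralTime (fun ω : ℝ => -(Complex.I * ω) * g ω) t) t := by
  refine (hasDerivAt_integral_of_dominated_loc_of_deriv_le (μ := volume)
    (F' := fun (t ω : ℝ) => -(Complex.I * ω) * g ω * Complex.exp (-(Complex.I * ω * t)))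
    (bound := fun ω => ‖-(Complex.I * ω) * g ω‖) univ_mem
    (Eventually.of_forall fun t => (integrable_mul_phase hg t).1) (integrable_mul_phase hg t)
    (integrable_mul_phase hg₁ t).1 (Eventually.of_forall fun ω t _ => ?_) hg₁.norm
    (Eventually.of_forall fun ω t _ => ?_)).2
  · rw [norm_mul, norm_exp_phase, mul_one]
  · have h1 : HasDerivAt (fun t : ℝ => -(Complex.I * ω * t)) (-(Complex.I * ω)) t := by
      simpa using (Complex.ofRealCLM.hasDerivAt (x := t)).const_mul (-(Complex.I * ω))
    convert! (h1.cexp).const_mul (g ω) using 1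
    ring

/-- The multiplier of the time derivative. -/
noncomputable def timeMultiplier (g : ℝ → ℂ) (ω : ℝ) : ℂ := -(Complex.I * ω) * g ω

/-- Since `f` is real it is the real part of its Fourier representation, which is differentiated
twice under the integral; the factor `1 / √(2π) ≤ 1` is dropped from the bounds. -/
lemma contDiff_of_hasTemporalTransform {f : ℝ → ℝ} {g : ℝ → ℂ} (hf : HasTemporalTransform f g)
    (h₁ : Integrable (timeMultiplier g)) (h₂ : Integrable (timeMultiplier (timeMultiplier g))) :
    ContDiff ℝ 2 f ∧ ∀ t, |f t| ≤ ‖fourierIntegralTime g t‖ ∧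
      |deriv f t| ≤ ‖fourierIntegralTime (timeMultiplier g) t‖ ∧
      |deriv (deriv f) t| ≤ ‖fourierIntegralTime (timeMultiplier (timeMultiplier g)) t‖ := by
  set K : ℂ := ((Real.sqrt (2 * Real.pi) : ℝ) : ℂ)⁻¹ with hK
  have hK1 : ‖K‖ ≤ 1 := by
    rw [hK, norm_inv, Complex.norm_real, Real.norm_of_nonneg (Real.sqrt_nonneg _)]
    refine inv_le_one_of_one_le₀ (Real.one_le_sqrt.2 ?_)
    linarith [Real.pi_gt_three]
  have hle : ∀ z : ℂ, |(K * z).re| ≤ ‖z‖ := fun z => (Complex.abs_re_le_norm _).trans (by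
    rw [norm_mul]
    exact mul_le_of_le_one_left (norm_nonneg _) hK1)
  have hre : ∀ {F : ℝ → ℂ} {z : ℂ} {t : ℝ}, HasDerivAt F z t →
      HasDerivAt (fun t => (K * F t).re) (K * z).re t := fun h =>
    Complex.reCLM.hasFDerivAt.comp_hasDerivAt _ (h.const_mul K)
  have e0 : f = fun t => (K * fourierIntegralTime g t).re := by
    ext t
    rw [← Complex.ofReal_re (f t), hf.2 t]
    rfl
  have d0 : ∀ t, HasDerivAt f (K * fourierIntegralTime (timeMultiplier g) t).re t := fun t => by
    rw [e0]
    exact hre (hasDerivAt_fourierIntegralTime hf.1 h₁ t)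
  have e1 : deriv f = fun t => (K * fourierIntegralTime (timeMultiplier g) t).re :=
    funext fun t => (d0 t).deriv
  have d1 : ∀ t, HasDerivAt (deriv f)
      (K * fourierIntegralTime (timeMultiplier (timeMultiplier g)) t).re t := fun t => by
    rw [e1]
    exact hre (hasDerivAt_fourierIntegralTime h₁ h₂ t)
  have e2 : deriv (deriv f) =
      fun t => (K * fourierIntegralTime (timeMultiplier (timeMultiplier g)) t).re :=
    funext fun t => (d1 t).deriv
  refine ⟨(contDiff_succ_iff_deriv (n := 1)).2 ⟨fun t => (d0 t).differentiableAt, by simp,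
    contDiff_one_iff_deriv.2 ⟨fun t => (d1 t).differentiableAt, ?_⟩⟩, fun t => ⟨?_, ?_, ?_⟩⟩
  · rw [e2]
    exact Complex.continuous_re.comp (continuous_const.mul (continuous_fourierIntegralTime h₂))
  · rw [e0]; exact hle _
  · rw [e1]; exact hle _
  · rw [e2]; exact hle _

/-! ### Sources with uniformly convergent space-frequency integrals -/

lemma norm_weighted (Ga : Space → ℝ → ℂ) (x r : Space) (ω : ℝ) :
    ‖weighted Ga x (r, ω)‖ = (1 + ω ^ 2) * ‖Ga r ω‖ / ‖x - r‖ := by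
  rw [weighted, norm_smul, Real.norm_of_nonneg (by positivity)]
  ring

/-- Fubini makes the weighted integral of `Ga` the Newtonian integral of this weight, and the part
of `cutOff` near the singular point controls its local smallness. -/
lemma UniformlyAbsolutelyConvergent.katoWeight {Ga : Space → ℝ → ℂ}
    (h : UniformlyAbsolutelyConvergent Ga) :
    KatoWeight fun r => ∫ ω, (1 + ω ^ 2) * ‖Ga r ω‖ := by
  have e : ∀ x r, (∫ ω, (1 + ω ^ 2) * ‖Ga r ω‖) / ‖x - r‖ = ∫ ω, ‖weighted Ga x (r, ω)‖ := by
    intro x r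
    simp only [norm_weighted, integral_div]
  refine ⟨fun r => integral_nonneg fun ω => by positivity, fun x => ?_, fun x₀ ε hε => ?_⟩
  · simp only [e]
    exact (h.1 x).norm.integral_prod_left
  · obtain ⟨R, hR, hle⟩ := h.2 (closedBall x₀ 1) (isCompact_closedBall _ _) ε hε
    -- Two points of a ball of radius `1 / (2 * R)` are less than `1 / R` apart, hence inside the
    -- cut-off region; the 1 keeps `x` in the compact set.
    refine ⟨min 1 (1 / (2 * R)), by positivity, fun x hx => ?_⟩
    have hx1 : x ∈ closedBall x₀ 1 :=
      ball_subset_closedBall (ball_subset_ball (min_le_left _ _) hx)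
    refine le_trans ?_ (hle x hx1)
    simp only [e]
    have hi := (h.1 x).norm
    have e1 : ∫ r in ball x₀ (min 1 (1 / (2 * R))), ∫ ω, ‖weighted Ga x (r, ω)‖ =
        ∫ z in ball x₀ (min 1 (1 / (2 * R))) ×ˢ univ, ‖weighted Ga x z‖ := by
      rw [Measure.volume_eq_prod, setIntegral_prod]
      · simp
      · exact hi.integrableOn
    rw [e1]
    refine setIntegral_mono_set hi.integrableOn (Eventually.of_forall fun _ => norm_nonneg _)
      (LE.le.eventuallyLE ?_)
    rintro ⟨r, ω⟩ ⟨hr, -⟩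
    refine Or.inr (Or.inr ?_)
    simp only at hr ⊢
    rw [← dist_eq_norm]
    have h1 := dist_triangle_right x r x₀
    rw [mem_ball] at hx hr
    have h2 := min_le_right 1 (1 / (2 * R))
    have h3 : 1 / (2 * R) + 1 / (2 * R) = 1 / R := by field_simp; norm_num
    linarith

lemma UniformlyAbsolutelyConvergent.admissibleSource {Ga : Space → ℝ → ℂ} {f : Space → ℝ → ℝ}
    (h : UniformlyAbsolutelyConvergent Ga) (hf : IsRegular 1 f)
    (hfa : ∀ r, HasTemporalTransform (f r) (Ga r)) :
    AdmissibleSource (fun r => ∫ ω, (1 + ω ^ 2) * ‖Ga r ω‖) f := by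
  -- Any base point would do; at `0`, almost every frequency slice is integrable, and the factor `1
  -- / ‖0 - r‖` is a nonzero constant in `ω`.
  have hae : ∀ᵐ r, Integrable fun ω => (1 + ω ^ 2) * ‖Ga r ω‖ := by
    filter_upwards [(h.1 0).norm.prod_right_ae, ae_ne_point 0] with r hr hne
    have h0 : ‖0 - r‖ ≠ 0 := norm_ne_zero_iff.2 (sub_ne_zero.2 hne)
    refine (hr.mul_const ‖0 - r‖).congr (Eventually.of_forall fun ω => ?_)
    simp only [norm_weighted]
    field_simp
  have key : ∀ᵐ r, ContDiff ℝ 2 (f r) ∧ ∀ t, |f r t| ≤ ∫ ω, (1 + ω ^ 2) * ‖Ga r ω‖ ∧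
      |deriv (f r) t| ≤ ∫ ω, (1 + ω ^ 2) * ‖Ga r ω‖ ∧
      |deriv (deriv (f r)) t| ≤ ∫ ω, (1 + ω ^ 2) * ‖Ga r ω‖ := by
    filter_upwards [hae] with r hr
    -- The factor `1 + ω ^ 2` dominates `1`, `|ω|` and `ω ^ 2`, the multipliers of the first three
    -- time derivatives, counting order zero.
    have n0 : ∀ ω, ‖Ga r ω‖ ≤ (1 + ω ^ 2) * ‖Ga r ω‖ := fun ω =>
      le_mul_of_one_le_left (norm_nonneg _) (by nlinarith [sq_nonneg ω])
    have n1 : ∀ ω, ‖timeMultiplier (Ga r) ω‖ ≤ (1 + ω ^ 2) * ‖Ga r ω‖ := fun ω => by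
      rw [timeMultiplier, norm_mul, norm_neg, norm_mul, Complex.norm_I, one_mul,
        Complex.norm_real, Real.norm_eq_abs]
      refine mul_le_mul_of_nonneg_right ?_ (norm_nonneg _)
      nlinarith [sq_abs ω, sq_nonneg (|ω| - 1)]
    have n2 : ∀ ω, ‖timeMultiplier (timeMultiplier (Ga r)) ω‖ ≤ (1 + ω ^ 2) * ‖Ga r ω‖ :=
      fun ω => by
      rw [timeMultiplier, timeMultiplier, norm_mul, norm_mul, norm_neg, norm_mul, Complex.norm_I,
        one_mul, Complex.norm_real, Real.norm_eq_abs, ← mul_assoc]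
      refine mul_le_mul_of_nonneg_right ?_ (norm_nonneg _)
      nlinarith [sq_abs ω]
    have m1 : AEStronglyMeasurable (timeMultiplier (Ga r)) :=
      (Continuous.aestronglyMeasurable (by fun_prop)).mul (hfa r).1.1
    have m2 : AEStronglyMeasurable (timeMultiplier (timeMultiplier (Ga r))) :=
      (Continuous.aestronglyMeasurable (by fun_prop)).mul m1
    have i1 := hr.mono' m1 (Eventually.of_forall n1)
    have i2 := hr.mono' m2 (Eventually.of_forall n2)
    obtain ⟨hC, hb⟩ := contDiff_of_hasTemporalTransform (hfa r) i1 i2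
    refine ⟨hC, fun t => ⟨(hb t).1.trans ?_, (hb t).2.1.trans ?_, (hb t).2.2.trans ?_⟩⟩
    · exact (norm_fourierIntegralTime_le _ t).trans (integral_mono (hfa r).1.norm hr n0)
    · exact (norm_fourierIntegralTime_le _ t).trans (integral_mono i1.norm hr n1)
    · exact (norm_fourierIntegralTime_le _ t).trans (integral_mono i2.norm hr n2)
  exact ⟨h.katoWeight, hf, key.mono fun r hr => hr.1, key.mono fun r hr t => (hr.2 t).1,
    key.mono fun r hr t => (hr.2 t).2.1, key.mono fun r hr t => (hr.2 t).2.2⟩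

/-! ### Band-limited sources of bounded support -/

/-- For the zero weight `kernelBound` is the bare inverse-square singularity, so its estimates can
be reused for bounded weights. -/
lemma katoWeight_zero : KatoWeight fun _ => 0 where
  nonneg _ := le_rfl
  integrable _ := by simp
  small _ ε hε := ⟨1, one_pos, fun _ _ => by simpa using hε.le⟩

/-- Globally `1 / d` is integrable over a bounded set. Locally `d ≤ 1`, so `C / d ≤ C / d²`, and the
smallness of the inverse-square integral suffices. -/
lemma katoWeight_indicator {C : ℝ} (hC : 0 ≤ C) (R : ℝ) :
    KatoWeight ((ball (0 : Space) R).indicator fun _ => C) where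
  nonneg r := indicator_nonneg (fun _ _ => hC) r
  integrable x := by
    have h := (((integrable_indicator_inv_norm (R + ‖x‖)).comp_sub_left x).const_mul C)
    refine h.mono' (Measurable.aestronglyMeasurable
      ((measurable_const.indicator measurableSet_ball).div (by fun_prop)))
      (Eventually.of_forall fun r => ?_)
    by_cases hr : r ∈ ball (0 : Space) R
    · have hxr : x - r ∈ ball (0 : Space) (R + ‖x‖) := by
        rw [mem_ball_zero_iff] at hr ⊢
        exact (norm_sub_le _ _).trans_lt (by linarith)
      rw [indicator_of_mem hr, indicator_of_mem hxr, Real.norm_of_nonneg (by positivity),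
        div_eq_mul_inv]
    · rw [indicator_of_notMem hr, zero_div, norm_zero]
      exact mul_nonneg hC (indicator_nonneg (fun _ _ => by positivity) _)
  small x₀ ε hε := by
    obtain ⟨δ, hδ, h⟩ := katoWeight_zero.kernelBound_small x₀
      (show 0 < ε / (C + 1) by positivity)
    refine ⟨min δ (1 / 2), by positivity, fun x hx => ?_⟩
    have hsub : ball x₀ (min δ (1 / 2)) ⊆ ball x₀ δ := ball_subset_ball (min_le_left _ _)
    have hi := (katoWeight_zero.integrable_kernelBound x₀ x).const_mul C
    have h1 : ∫ r in ball x₀ (min δ (1 / 2)), (ball (0 : Space) R).indicator (fun _ => C) r /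
        ‖x - r‖ ≤ ∫ r in ball x₀ (min δ (1 / 2)), C * kernelBound (fun _ => 0) x₀ x r := by
      refine integral_mono_of_nonneg (Eventually.of_forall fun r =>
        div_nonneg (indicator_nonneg (fun _ _ => hC) r) (norm_nonneg _)) hi.integrableOn ?_
      refine (ae_restrict_iff' measurableSet_ball).2 (Eventually.of_forall fun r hr => ?_)
      have hr2 : r ∈ ball x₀ 2 := ball_subset_ball ((min_le_right _ _).trans (by norm_num)) hr
      have hxr : ‖x - r‖ ≤ 1 := by
        rw [← dist_eq_norm]
        have := dist_triangle_right x r x₀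
        rw [mem_ball] at hx hr
        have := min_le_right δ (1 / 2)
        linarith
      simp only [kernelBound, zero_div, add_zero, indicator_of_mem hr2]
      rcases eq_or_ne ‖x - r‖ 0 with h0 | h0
      · simp [h0]
      have hpos : 0 < ‖x - r‖ := lt_of_le_of_ne (norm_nonneg _) (Ne.symm h0)
      rw [mul_one_div]
      have hind : (ball (0 : Space) R).indicator (fun _ => C) r ≤ C :=
        indicator_le_self' (fun _ _ => hC) r
      refine div_le_div₀ hC hind (by positivity) ?_
      nlinarith
    refine h1.trans ((setIntegral_mono_set hi.integrableOn (Eventually.of_forall fun r =>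
      mul_nonneg hC (katoWeight_zero.kernelBound_nonneg x₀ x r)) (LE.le.eventuallyLE hsub)).trans ?_)
    rw [integral_const_mul]
    refine (mul_le_mul_of_nonneg_left (h x (hsub hx)) hC).trans ?_
    rw [← mul_div_assoc, div_le_iff₀ (by positivity)]
    nlinarith

open FourierTransform SchwartzMap in
/-- A Fourier multiplier with an integrable kernel is bounded for the supremum norm. -/
lemma norm_fourierIntegralTime_schwartz_mul_le (ψ : 𝓢(ℝ, ℂ)) {g : ℝ → ℂ} (hg : Integrable g)
    {B : ℝ} (hB : ∀ t, ‖fourierIntegralTime g t‖ ≤ B) (t : ℝ) :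
    ‖fourierIntegralTime (fun ω => ψ ω * g ω) t‖ ≤ (∫ s, ‖(𝓕⁻ ψ : 𝓢(ℝ, ℂ)) s‖) * B := by
  set h : 𝓢(ℝ, ℂ) := 𝓕⁻ ψ with hh
  have hψ : ∀ ω : ℝ, ψ ω = ∫ s : ℝ, Complex.exp (((-2 * Real.pi * s * ω : ℝ) : ℂ) * Complex.I) •
      h s := by
    intro ω
    have h1 : 𝓕 h = ψ := fourier_fourierInv_eq ψ
    rw [← Real.fourier_real_eq_integral_exp_smul, ← SchwartzMap.fourier_coe, h1]
  have hprod : Integrable (fun z : ℝ × ℝ =>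
      h z.2 * (g z.1 * Complex.exp (-(Complex.I * z.1 * ((t + 2 * Real.pi * z.2 : ℝ) : ℂ)))))
      (volume.prod volume) := by
    have h1 : Integrable (fun z : ℝ × ℝ => g z.1 * h z.2) (volume.prod volume) :=
      hg.mul_prod h.integrable
    refine h1.mono ?_ (Eventually.of_forall fun z => ?_)
    · refine (h1.1.mul (Continuous.aestronglyMeasurable (f := fun z : ℝ × ℝ =>
        Complex.exp (-(Complex.I * z.1 * ((t + 2 * Real.pi * z.2 : ℝ) : ℂ)))) (by fun_prop))).congr
        (Eventually.of_forall fun z => ?_)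
      simp only [Pi.mul_apply]
      ring
    · rw [norm_mul, norm_mul, norm_exp_phase, mul_one, norm_mul, mul_comm]
  -- Inserting `ψ` as the Fourier transform of `h` and exchanging integrals shows that the
  -- multiplier acts by averaging time translates against `h`; the `2π` comes from the normalization
  -- of `𝓕`.
  have e : fourierIntegralTime (fun ω => ψ ω * g ω) t =
      ∫ s : ℝ, h s * fourierIntegralTime g (t + 2 * Real.pi * s) := by
    simp only [fourierIntegralTime, ← integral_const_mul]
    rw [← integral_integral_swap hprod]
    congr 1
    ext ω
    rw [hψ, ← integral_mul_const, ← integral_mul_const]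
    congr 1
    ext s
    have : Complex.exp (-(Complex.I * ω * ((t + 2 * Real.pi * s : ℝ) : ℂ))) =
        Complex.exp (((-2 * Real.pi * s * ω : ℝ) : ℂ) * Complex.I) *
          Complex.exp (-(Complex.I * ω * t)) := by
      rw [← Complex.exp_add]
      congr 1
      push_cast
      ring
    rw [this, smul_eq_mul]
    ring
  rw [e, ← integral_mul_const]
  refine norm_integral_le_of_norm_le (h.integrable.norm.mul_const B)
    (Eventually.of_forall fun s => ?_)
  rw [norm_mul]
  exact mul_le_mul_of_nonneg_left (hB _) (norm_nonneg _)

open FourierTransform SchwartzMap in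
/-- Bernstein's inequality up to constants: band-limited bounded functions of time have bounded
derivatives, with constants that depend only on the band. -/
lemma exists_bernstein {B : Set ℝ} (hB : Bornology.IsBounded B) :
    ∃ C, 1 ≤ C ∧ ∀ (f : ℝ → ℝ) (g : ℝ → ℂ) (m : ℝ), HasTemporalTransform f g →
      (∀ ω ∉ B, g ω = 0) → (∀ t, |f t| ≤ m) →
      ContDiff ℝ 2 f ∧ ∀ t, |deriv f t| ≤ C * m ∧ |deriv (deriv f) t| ≤ C * m := by
  obtain ⟨σ, hσ⟩ := hB.subset_closedBall 0
  -- The plateau of the bump covers the band, so multiplying by `-iω` and by the smooth compactly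
  -- supported `-iωχ(ω)` agree on functions supported in `B`. Absolute values keep the radii
  -- positive even if `σ` is negative.
  let χ : ContDiffBump (0 : ℝ) := ⟨|σ| + 1, |σ| + 2, by positivity, by linarith⟩
  have hχ1 : ∀ ω ∈ B, χ ω = 1 := fun ω hω => χ.one_of_mem_closedBall
    (closedBall_subset_closedBall (by
      have := le_abs_self σ
      change σ ≤ |σ| + 1
      linarith) (hσ hω))
  have hsm : ContDiff ℝ ((⊤ : ℕ∞) : WithTop ℕ∞) fun ω : ℝ => ((χ ω : ℝ) : ℂ) :=
    Complex.ofRealCLM.contDiff.comp χ.contDiff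
  have hlin : ContDiff ℝ ((⊤ : ℕ∞) : WithTop ℕ∞) fun ω : ℝ => -(Complex.I * (ω : ℂ)) :=
    (contDiff_const.mul Complex.ofRealCLM.contDiff).neg
  have hsupp : HasCompactSupport fun ω : ℝ => ((χ ω : ℝ) : ℂ) :=
    χ.hasCompactSupport.comp_left Complex.ofReal_zero
  set ψ₁ : 𝓢(ℝ, ℂ) := hsupp.mul_left.toSchwartzMap (hlin.mul hsm) with hψ₁
  set ψ₂ : 𝓢(ℝ, ℂ) := hsupp.mul_left.mul_left.toSchwartzMap (hlin.mul (hlin.mul hsm)) with hψ₂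
  have nonneg : ∀ ψ : 𝓢(ℝ, ℂ), 0 ≤ ∫ s, ‖(𝓕⁻ ψ : 𝓢(ℝ, ℂ)) s‖ := fun ψ =>
    integral_nonneg fun _ => norm_nonneg _
  set S := Real.sqrt (2 * Real.pi) with hS
  have hS0 : 0 < S := Real.sqrt_pos.2 (by positivity)
  set K₁ := ∫ s, ‖(𝓕⁻ ψ₁ : 𝓢(ℝ, ℂ)) s‖ with hK₁
  set K₂ := ∫ s, ‖(𝓕⁻ ψ₂ : 𝓢(ℝ, ℂ)) s‖ with hK₂
  have n1 : 0 ≤ K₁ * S := mul_nonneg (nonneg ψ₁) hS0.le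
  have n2 : 0 ≤ K₂ * S := mul_nonneg (nonneg ψ₂) hS0.le
  refine ⟨1 + K₁ * S + K₂ * S, by linarith, fun f g m hf hg hm => ?_⟩
  have hm0 : 0 ≤ m := (abs_nonneg _).trans (hm 0)
  -- Fourier inversion turns the sup bound on `f` into one on the Fourier integral; no bound on the
  -- L¹ norm of `g` enters, so the constants are uniform in the spatial point.
  have hbd : ∀ t, ‖fourierIntegralTime g t‖ ≤ S * m := by
    intro t
    have h := hf.2 t
    rw [eq_inv_mul_iff_mul_eq₀ (by exact_mod_cast hS0.ne')] at h
    change _ = fourierIntegralTime g t at h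
    rw [← h, norm_mul, Complex.norm_real, Complex.norm_real, Real.norm_of_nonneg hS0.le]
    exact mul_le_mul_of_nonneg_left (hm t) hS0.le
  have e1 : timeMultiplier g = fun ω => ψ₁ ω * g ω := by
    ext ω
    have h1 : ψ₁ ω = -(Complex.I * ω) * ((χ ω : ℝ) : ℂ) := rfl
    by_cases hω : ω ∈ B
    · rw [h1, hχ1 ω hω, timeMultiplier]
      simp
    · rw [timeMultiplier, hg ω hω, mul_zero, mul_zero]
  have e2 : timeMultiplier (timeMultiplier g) = fun ω => ψ₂ ω * g ω := by
    ext ω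
    have h1 : ψ₂ ω = -(Complex.I * ω) * (-(Complex.I * ω) * ((χ ω : ℝ) : ℂ)) := rfl
    by_cases hω : ω ∈ B
    · rw [h1, hχ1 ω hω, timeMultiplier, timeMultiplier]
      simp [mul_assoc]
    · rw [timeMultiplier, timeMultiplier, hg ω hω, mul_zero, mul_zero, mul_zero]
  have hint : ∀ ψ : 𝓢(ℝ, ℂ), Integrable fun ω => ψ ω * g ω := fun ψ => by
    obtain ⟨C, hC⟩ := ψ.decay 0 0
    refine hf.1.bdd_mul (c := C) ψ.continuous.aestronglyMeasurable
      (Eventually.of_forall fun ω => by simpa using hC.2 ω)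
  obtain ⟨hcd, hb⟩ := contDiff_of_hasTemporalTransform hf (by rw [e1]; exact hint ψ₁)
    (by rw [e2]; exact hint ψ₂)
  refine ⟨hcd, fun t => ⟨(hb t).2.1.trans ?_, (hb t).2.2.trans ?_⟩⟩
  · rw [e1]
    refine (norm_fourierIntegralTime_schwartz_mul_le ψ₁ hf.1 hbd t).trans ?_
    rw [← mul_assoc]
    exact mul_le_mul_of_nonneg_right (by linarith) hm0
  · rw [e2]
    refine (norm_fourierIntegralTime_schwartz_mul_le ψ₂ hf.1 hbd t).trans ?_
    rw [← mul_assoc]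
    exact mul_le_mul_of_nonneg_right (by linarith) hm0

/-- Bounded band-limited sources of bounded support are admissible. -/
lemma exists_admissibleSource_of_bandLimited {f : Space → ℝ → ℝ} {fa : Space → ℝ → ℂ}
    (hf : IsRegular 1 f) (hfa : ∀ r, HasTemporalTransform (f r) (fa r)) {m : ℝ}
    (hm : ∀ r t, |f r t| ≤ m) {D : Set Space} (hD : Bornology.IsBounded D)
    (hfD : ∀ r ∉ D, ∀ t, f r t = 0) {B : Set ℝ} (hB : Bornology.IsBounded B)
    (hfB : ∀ r, ∀ ω ∉ B, fa r ω = 0) : ∃ M, AdmissibleSource M f := by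
  obtain ⟨C, hC, hbern⟩ := exists_bernstein hB
  obtain ⟨R, hR⟩ := hD.subset_ball 0
  have hm0 : 0 ≤ m := (abs_nonneg _).trans (hm 0 0)
  have hb := fun r => hbern (f r) (fa r) m (hfa r) (hfB r) (hm r)
  have hle : ∀ (r : Space) (y : ℝ), |y| ≤ C * m → (r ∉ D → y = 0) →
      |y| ≤ (ball (0 : Space) R).indicator (fun _ => C * m) r := by
    intro r y h1 h2
    by_cases hr : r ∈ ball (0 : Space) R
    · rwa [indicator_of_mem hr]
    · rw [indicator_of_notMem hr, h2 fun h => hr (hR h), abs_zero]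
  have hzero : ∀ r ∉ D, f r = fun _ => 0 := fun r hr => funext (hfD r hr)
  refine ⟨_, katoWeight_indicator (C := C * m) (mul_nonneg (by linarith) hm0) R, hf,
    Eventually.of_forall fun r => (hb r).1, Eventually.of_forall fun r t => ?_,
    Eventually.of_forall fun r t => ?_, Eventually.of_forall fun r t => ?_⟩
  · exact hle r _ ((hm r t).trans (le_mul_of_one_le_left hm0 hC)) fun hr => hfD r hr t
  · exact hle r _ ((hb r).2 t).1 fun hr => by simp [hzero r hr]
  · exact hle r _ ((hb r).2 t).2 fun hr => by simp [hzero r hr]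

lemma IsRegular.component {n : ℕ} {j : Space → ℝ → Space} (hj : IsRegular n j) (k : Fin 3) :
    IsRegular n fun r t => j r t k :=
  contDiff_euclidean.1 hj k

end Electrodynamics

/-! ### The theorem under each of the two alternatives. -/

theorem mainTheorem1
    (c : ℝ) (hc : 0 < c)
    (ρ : Electrodynamics.Space → ℝ → ℝ)
    (j : Electrodynamics.Space → ℝ → Electrodynamics.Space)
    (hρ : Electrodynamics.IsRegular 1 ρ) (hj : Electrodynamics.IsRegular 1 j)
    (hcont : Electrodynamics.ContinuityEquation ρ j)
    (ρa : Electrodynamics.Space → ℝ → ℂ)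
    (ja : Fin 3 → Electrodynamics.Space → ℝ → ℂ)
    (hρa : ∀ r, Electrodynamics.HasTemporalTransform (ρ r) (ρa r))
    (hja : ∀ k r, Electrodynamics.HasTemporalTransform (fun t => j r t k) (ja k r)) :
    -- bounded sources with bounded spatial support and bounded frequency spectrum
    ((∃ M : ℝ, ∀ r t, |ρ r t| ≤ M ∧ ‖j r t‖ ≤ M) →
      (∃ D : Set Electrodynamics.Space, Bornology.IsBounded D ∧
        ∀ r ∉ D, ∀ t, ρ r t = 0 ∧ j r t = 0) →
      (∃ B : Set ℝ, Bornology.IsBounded B ∧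
        ∀ r, ∀ ω ∉ B, ρa r ω = 0 ∧ ∀ k, ja k r ω = 0) →
      Electrodynamics.DelayedPotentialsSolve c ρ j) ∧
    -- no support conditions, but uniform absolute convergence of the space-frequency integrals
    (Electrodynamics.UniformlyAbsolutelyConvergent ρa →
      (∀ k, Electrodynamics.UniformlyAbsolutelyConvergent (ja k)) →
      Electrodynamics.DelayedPotentialsSolve c ρ j) := by
  have comp := fun k => Electrodynamics.IsRegular.component hj k
  constructor
  · rintro ⟨m, hm⟩ ⟨D, hD, hD0⟩ ⟨B, hB, hB0⟩
    obtain ⟨M, hM⟩ := Electrodynamics.exists_admissibleSource_of_bandLimited hρ hρa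
      (fun r t => (hm r t).1) hD (fun r hr t => (hD0 r hr t).1) hB (fun r ω hω => (hB0 r ω hω).1)
    choose N hN using fun k => Electrodynamics.exists_admissibleSource_of_bandLimited (comp k)
      (hja k) (fun r t => (PiLp.norm_apply_le (j r t) k).trans (hm r t).2) hD
      (fun r hr t => by rw [(hD0 r hr t).2]; rfl) hB (fun r ω hω => (hB0 r ω hω).2 k)
    exact Electrodynamics.delayedPotentialsSolve_of_admissible hc hM hN hcont
  · intro hρu hju
    exact Electrodynamics.delayedPotentialsSolve_of_admissible hc (hρu.admissibleSource hρ hρa)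
      (fun k => (hju k).admissibleSource (comp k) (hja k)) hcont
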